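/- Let $p$ be an odd prime, $m\ge 1$ an integer and $q=p^m$. Let $U=\{x^2 : x\in \mathrm{GF}(q)\}$ (so $0\in U$), and let $C_1$ be the linear code over $\mathrm{GF}(q)$ whose generator matrix $G_1$ has the columns $(x,y,1)^T$ for $x\in U$, $y\in\mathrm{GF}(q)$, together with the two columns $(1,0,0)^T$ and $(0,1,0)^T$. Let $C_1^{(p)}$ be its subfield code: the linear code over $\mathrm{GF}(p)$ generated by the rows of the $3m$-row matrix obtained from a generator matrix $G$ of $C_1$ by replacing each entry by the column of its coordinates with respect to a basis of $\mathrm{GF}(q)$ over $\mathrm{GF}(p)$. The following holds for every choice of the basis and of the generator matrix $G$ of $C_1$. In the tables, rows with equal weight are to be added, and weights not listed have multiplicity $0$. (1) If $m=1$, then $C_1^{(p)}$ is a $[\frac{p^2+p}{2}+2,\,3,\,\frac{p^2-p+2}{2}]$ code, and its dual $C_1^{(p)\perp}$ is an almost MDS $[\frac{p^2+p}{2}+2,\,\frac{p^2+p}{2}-1,\,3]$ code (almost MDS: an $[n,k,n-k]$ code). If $m>1$ is odd, then $C_1^{(p)}$ is a $$\Big[\tfrac{p^{2m}+p^m}{2}+2,\;2m+1,\;\tfrac{p^{2m}+p^m-p^{2m-1}-p^{(3m-1)/2}}{2}\Big]$$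 code. For every odd $m\ge1$ the weight distribution of $C_1^{(p)}$ is the following, where $u=\frac{p^{2m}+p^m-p^{2m-1}-p^{m-1}}{2}$, $v=\frac{p^{2m}-p^{2m-1}}{2}$ and $w_{\pm}=\frac{p^{2m}+p^m-p^{2m-1}\pm p^{(3m-1)/2}(-1)^{(m+1)(p-1)/4}}{2}$. | Weight | Multiplicity | |---|---| | $0$ | $1$ | | $\frac{p^{2m}+p^m}{2}$ | $p-1$ | | $u$ | $(p^{m-1}-1)p^m$ | | $u+1$ | $(p^m-p^{m-1})(2p^m-p)$ | | $u+2$ | $p(p^m-p^{m-1})^2$ | | $v$ | $p^{m-1}-1$ | | $v+1$ | $p^m-p^{m-1}$ | | $w_-$ | $\frac{(p^{m-1}-1)(p-1)}{2}$ | | $w_-+1$ | $\frac{p^{m-1}(p-1)^2}{2}$ | | $w_+$ | $\frac{(p^{m-1}-1)(p-1)}{2}$ | | $w_++1$ | $\frac{p^{m-1}(p-1)^2}{2}$ | (2) If $m$ is even, then $C_1^{(p)}$ is a $$\Big[\tfrac{p^{2m}+p^m}{2}+2,\;2m+1,\;\tfrac{p^{2m}-p^{2m-1}-(p-1)p^{(3m-2)/2}}{2}\Big]$$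 code, and its weight distribution is the following, where $u$ is as in (1), $s=(-1)^{m(p-1)/4}$, $g=s\,p^{(m-2)/2}$, $v_{\pm}=\frac{p^{2m}-p^{2m-1}\pm(p-1)s\,p^{(3m-2)/2}}{2}$ and $w_{\pm}=\frac{p^{2m}+p^m-p^{2m-1}\pm s\,p^{(3m-2)/2}}{2}$. | Weight | Multiplicity | |---|---| | $0$ | $1$ | | $\frac{p^{2m}+p^m}{2}$ | $p-1$ | | $u$ | $(p^{m-1}-1)p^m$ | | $u+1$ | $(p^m-p^{m-1})(2p^m-p)$ | | $u+2$ | $p(p^m-p^{m-1})^2$ | | $v_+$ | $\frac{p^{m-1}-1-(p-1)g}{2}$ | | $v_++1$ | $\frac{(p-1)(p^{m-1}+g)}{2}$ | | $v_-$ | $\frac{p^{m-1}-1+(p-1)g}{2}$ | | $v_-+1$ | $\frac{(p-1)(p^{m-1}-g)}{2}$ | | $w_-$ | $\frac{(p-1)(p^{m-1}-1-(p-1)g)}{2}$ | | $w_-+1$ | $\frac{(p-1)^2(p^{m-1}+g)}{2}$ | | $w_+$ | $\frac{(p-1)(p^{m-1}-1+(p-1)g)}{2}$ | | $w_++1$ |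 $\frac{(p-1)^2(p^{m-1}-g)}{2}$ | (3) For every $m\ge1$, the dual $C_1^{(p)\perp}$ is a $[\frac{p^{2m}+p^m}{2}+2,\;\frac{p^{2m}+p^m}{2}-2m+1,\;3]$ code. It is dimension-optimal with respect to the sphere-packing bound: with $n$ its length and $d=3$, every $k$ with $p^{k}\sum_{i=0}^{\lfloor (d-1)/2\rfloor}(p-1)^i\binom{n}{i}\le p^{n}$ is at most its dimension, and consequently no linear code over $\mathrm{GF}(p)$ of length $n$ and minimum distance at least $3$ has larger dimension. -/

import Mathlib

/-! ### Linear codes: a code of length `|ι|` over `K` is a `K`-subspace of `ι → K`. -/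

/-- The code generated by the rows of a matrix. -/
def rowCode {K κ ι : Type*} [Field K] (G : Matrix κ ι K) : Submodule K (ι → K) :=
  Submodule.span K (Set.range fun i => G i)

/-- `G` is a generator matrix of `C`: its rows form a basis of `C`. -/
def IsGeneratorMatrix {K κ ι : Type*} [Field K] (G : Matrix κ ι K)
    (C : Submodule K (ι → K)) : Prop :=
  LinearIndependent K (fun i => G i) ∧ rowCode G = C

/-- Replace each entry `g` of a matrix `G` over `L` by the column of the coordinates of `g`
with respect to a basis `B` of `L` over the subfield `K`. -/
noncomputable def expandMatrix {K L κ ι β : Type*} [Field K] [Field L] [Algebra K L]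
    (B : Module.Basis β K L) (G : Matrix κ ι L) : Matrix (κ × β) ι K :=
  fun r j => B.repr (G r.1 j) r.2

/-- The subfield code: the code over `K` generated by the expansion, with respect to the
basis `B`, of a generator matrix `G` of a code over `L`. -/
noncomputable def subfieldCode {K L κ ι β : Type*} [Field K] [Field L] [Algebra K L]
    (B : Module.Basis β K L) (G : Matrix κ ι L) : Submodule K (ι → K) :=
  rowCode (expandMatrix B G)

/-- The (Euclidean) dual code. -/
def dualCode {K ι : Type*} [Field K] [Fintype ι] (C : Submodule K (ι → K)) :
    Submodule K (ι → K) where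
  carrier := {v | ∀ c ∈ C, v ⬝ᵥ c = 0}
  zero_mem' := fun c _ => zero_dotProduct c
  add_mem' := fun {v w} hv hw c hc => by rw [add_dotProduct, hv c hc, hw c hc, add_zero]
  smul_mem' := fun a v hv c hc => by rw [smul_dotProduct, hv c hc, smul_zero]

/-- `d` is the minimum distance of `C`: the least Hamming distance of two distinct codewords. -/
def IsMinDist {K ι : Type*} [Field K] [DecidableEq K] [Fintype ι]
    (C : Submodule K (ι → K)) (d : ℕ) : Prop :=
  IsLeast {e : ℕ | ∃ x ∈ C, ∃ y ∈ C, x ≠ y ∧ hammingDist x y = e} d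

/-- `C` is an `[n, k, d]` code: length `n`, dimension `k`, minimum distance `d`. -/
def IsCode {K ι : Type*} [Field K] [DecidableEq K] [Fintype ι]
    (C : Submodule K (ι → K)) (n k d : ℕ) : Prop :=
  Fintype.card ι = n ∧ Module.finrank K C = k ∧ IsMinDist C d

/-- The number of codewords of Hamming weight `w`. -/
noncomputable def weightCount {K ι : Type*} [Field K] [DecidableEq K] [Fintype ι]
    (C : Submodule K (ι → K)) (w : ℕ) : ℕ :=
  {c : ι → K | c ∈ C ∧ hammingNorm c = w}.ncard

/-- The weight distribution of `C` is given by a table of rows (weight, multiplicity): the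
number of codewords of weight `w` is the sum of the multiplicities of the rows of weight `w`
(rows with the same weight are added up; weights that do not occur in the table have no
codewords). -/
def HasWeightTable {K ι : Type*} [Field K] [DecidableEq K] [Fintype ι]
    (C : Submodule K (ι → K)) (T : List (ℚ × ℚ)) : Prop :=
  ∀ w : ℕ, (weightCount C w : ℚ) = (T.map fun r => if r.1 = (w : ℚ) then r.2 else 0).sum

/-- `C` is almost MDS: an `[n, k, n - k]` code, that is, of Singleton defect one. -/
def IsAlmostMDS {K ι : Type*} [Field K] [DecidableEq K] [Fintype ι]
    (C : Submodule K (ι → K)) : Prop :=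
  ∃ d, IsMinDist C d ∧ d + Module.finrank K C = Fintype.card ι

/-- The sphere-packing (Hamming) bound for `[n, k, d]` codes over a field of `q` elements. -/
def SpherePackingBound (q n k d : ℕ) : Prop :=
  q ^ k * ∑ i ∈ Finset.range ((d - 1) / 2 + 1), (q - 1) ^ i * n.choose i ≤ q ^ n

/-- `C` is dimension-optimal with respect to the sphere-packing bound: no dimension larger
than that of `C` is compatible with the bound at the length and minimum distance of `C`, and
no linear code of the same length and at least the same minimum distance has a larger
dimension. -/
def IsDimensionOptimal {K ι : Type*} [Field K] [DecidableEq K] [Fintype ι]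
    (C : Submodule K (ι → K)) : Prop :=
  ∃ d, IsMinDist C d ∧
    (∀ k, SpherePackingBound (Nat.card K) (Fintype.card ι) k d → k ≤ Module.finrank K C) ∧
    ∀ (D : Submodule K (ι → K)) (d' : ℕ), IsMinDist D d' → d ≤ d' →
      Module.finrank K D ≤ Module.finrank K C

/-! ### The code `C₁` -/

/-- The positions of `C₁`: the pairs `(x, y)` with `x` a square in `F` (including `0`) and
`y ∈ F`, and two further positions. -/
abbrev Pos (F : Type*) [Field F] : Type _ := ({x : F // IsSquare x} × F) ⊕ Fin 2

/-- The matrix with columns `(x, y, 1)`, `x` a square and `y ∈ F`, and the two unit columns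
`(1, 0, 0)` and `(0, 1, 0)`. -/
def matG1 (F : Type*) [Field F] : Matrix (Fin 3) (Pos F) F := fun i j =>
  match j with
  | Sum.inl (x, y) => ![(x : F), y, 1] i
  | Sum.inr t => ![![1, 0, 0], ![0, 1, 0]] t i

/-- The code `C₁` over `F`. -/
def codeC1 (F : Type*) [Field F] : Submodule F (Pos F → F) := rowCode (matG1 F)

/-! ### The weight distributions -/

/-- The rows (weight, multiplicity) common to all `m`. -/
def tableCommon (p m : ℕ) : List (ℚ × ℚ) :=
  let P : ℚ := p
  let u : ℚ := (P ^ (2 * m) + P ^ m - P ^ (2 * m - 1) - P ^ (m - 1)) / 2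
  [(0, 1),
   ((P ^ (2 * m) + P ^ m) / 2, P - 1),
   (u, (P ^ (m - 1) - 1) * P ^ m),
   (u + 1, (P ^ m - P ^ (m - 1)) * (2 * P ^ m - P)),
   (u + 2, P * (P ^ m - P ^ (m - 1)) ^ 2)]

/-- The weight distribution for odd `m` (the exponents with a division are then integers). -/
def tableOdd (p m : ℕ) : List (ℚ × ℚ) :=
  let P : ℚ := p
  let v : ℚ := (P ^ (2 * m) - P ^ (2 * m - 1)) / 2
  let e : ℚ := P ^ ((3 * m - 1) / 2) * (-1) ^ ((m + 1) * (p - 1) / 4)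
  let w₁ : ℚ := (P ^ (2 * m) + P ^ m - P ^ (2 * m - 1) - e) / 2
  let w₂ : ℚ := (P ^ (2 * m) + P ^ m - P ^ (2 * m - 1) + e) / 2
  tableCommon p m ++
  [(v, P ^ (m - 1) - 1),
   (v + 1, P ^ m - P ^ (m - 1)),
   (w₁, (P ^ (m - 1) - 1) * (P - 1) / 2),
   (w₁ + 1, P ^ (m - 1) * (P - 1) ^ 2 / 2),
   (w₂, (P ^ (m - 1) - 1) * (P - 1) / 2),
   (w₂ + 1, P ^ (m - 1) * (P - 1) ^ 2 / 2)]

/-- The weight distribution for even `m ≥ 2` (the exponents with a division are then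
integers). -/
def tableEven (p m : ℕ) : List (ℚ × ℚ) :=
  let P : ℚ := p
  let s : ℚ := (-1) ^ (m * (p - 1) / 4)
  let e : ℚ := P ^ ((3 * m - 2) / 2) * s
  let g : ℚ := P ^ ((m - 2) / 2) * s
  let v₁ : ℚ := (P ^ (2 * m) - P ^ (2 * m - 1) + (P - 1) * e) / 2
  let v₂ : ℚ := (P ^ (2 * m) - P ^ (2 * m - 1) - (P - 1) * e) / 2
  let w₁ : ℚ := (P ^ (2 * m) + P ^ m - P ^ (2 * m - 1) - e) / 2
  let w₂ : ℚ := (P ^ (2 * m) + P ^ m - P ^ (2 * m - 1) + e) / 2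
  tableCommon p m ++
  [(v₁, (P ^ (m - 1) - 1 - (P - 1) * g) / 2),
   (v₁ + 1, (P - 1) * (P ^ (m - 1) + g) / 2),
   (v₂, (P ^ (m - 1) - 1 + (P - 1) * g) / 2),
   (v₂ + 1, (P - 1) * (P ^ (m - 1) - g) / 2),
   (w₁, (P - 1) * (P ^ (m - 1) - 1 - (P - 1) * g) / 2),
   (w₁ + 1, (P - 1) ^ 2 * (P ^ (m - 1) + g) / 2),
   (w₂, (P - 1) * (P ^ (m - 1) - 1 + (P - 1) * g) / 2),
   (w₂ + 1, (P - 1) ^ 2 * (P ^ (m - 1) - g) / 2)]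

/-! ### Squares on affine hyperplanes of a finite field -/

section CharacterSums

set_option linter.unusedSectionVars false

open Finset

/-! Write `Q = p`, `q = Q ^ m`, `A = q / Q`, and fix a nonzero `K`-linear form `τ` on `F`. Every
linear form is `x ↦ τ (a * x)`, so the subfield code is `τ` applied to `C₁`, whatever the basis and
generator matrix (`mem_subfieldCode_iff`). Its words are `(τ (a x + b y) + c, τ a, τ b)`,
parametrised injectively by `(a, b, c)` in `F × F × K`; hence the dimension `2m + 1`.

If `b ≠ 0`, then `τ (b y)` is equidistributed and the weight depends only on whether `τ a` and `τ b`
vanish. If `a = b = 0`, the word is constant on the pairs. If `b = 0 ≠ a`, one must count the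
squares on a hyperplane `τ (a x) = t`, that is, know `sqBias τ a t`.

No Gauss sums are evaluated. The biases sum to zero over `t`, their squares sum to `q - A`
(`sum_sqBias_sq`), and scaling `t` by `k` in `K` multiplies the bias by the quadratic character of
`K` at `k` to the power `m`. For odd `m` the bias is therefore a multiple of that character; for
even `m` it is constant off `t = 0`. The second moment then gives it up to a sign (`sqBias_of_odd`,
`sqBias_of_even`). The sign is never needed: flipping it only permutes the rows of the tables.

For the dual, any two positions are separated by a codeword, so no nonzero dual word has weight
below 3, and an explicit relation among three columns has weight 3. Optimality follows by packing
balls of radius one, since `p ^ (2m) < 1 + (p - 1) n`. -/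

theorem ringChar_algebra_ne_two {K F : Type*} [Field K] [Field F] [Algebra K F]
    (h2 : ringChar K ≠ 2) : ringChar F ≠ 2 := by
  rwa [← Algebra.ringChar_eq K F]

theorem comp_mulLeft_ne_zero {K F : Type*} [Field K] [Field F] [Algebra K F]
    {τ : F →ₗ[K] K} (hτ : τ ≠ 0) {a : F} (ha : a ≠ 0) :
    τ ∘ₗ LinearMap.mulLeft K a ≠ 0 := by
  intro h
  apply hτ
  ext x
  have := LinearMap.congr_fun h (a⁻¹ * x)
  simpa [mul_inv_cancel_left₀ ha] using this

theorem card_fiber_linearForm {K F : Type*} [Field K] [Fintype K] [DecidableEq K] [Field F]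
    [Fintype F] [Algebra K F] {n : ℕ} (hF : Fintype.card F = Fintype.card K ^ (n + 1))
    {φ : F →ₗ[K] K} (hφ : φ ≠ 0) (t : K) :
    #{x | φ x = t} = Fintype.card K ^ n := by
  have hs : Function.Surjective φ := LinearMap.surjective hφ
  have key : ∀ s : K, #{x | φ x = s} = #{x | φ x = t} := by
    intro s
    obtain ⟨z, hz⟩ := hs (t - s)
    refine Finset.card_bij (fun x _ => x + z) ?_ ?_ ?_
    · intro x hx
      simp only [mem_filter, mem_univ, true_and] at hx ⊢
      rw [map_add, hx, hz]; ring
    · intro x _ y _ h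
      exact add_right_cancel h
    · intro y hy
      simp only [mem_filter, mem_univ, true_and] at hy
      refine ⟨y - z, ?_, by ring⟩
      simp only [mem_filter, mem_univ, true_and]
      rw [map_sub, hy, hz]; ring
  have h1 := Finset.card_eq_sum_card_fiberwise (s := (univ : Finset F)) (t := (univ : Finset K))
    (f := φ) (fun x _ => mem_coe.2 (mem_univ _))
  rw [Finset.sum_congr rfl (fun s _ => key s), Finset.sum_const, card_univ, card_univ, hF,
    smul_eq_mul, pow_succ'] at h1
  exact (Nat.eq_of_mul_eq_mul_left Fintype.card_pos h1).symm

variable {K F : Type*} [Field K] [Fintype K] [DecidableEq K] [Field F] [Fintype F]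
  [DecidableEq F] [Algebra K F]

theorem sum_indicator_form {n : ℕ} (hF : Fintype.card F = Fintype.card K ^ (n + 1))
    {τ : F →ₗ[K] K} (hτ : τ ≠ 0) {R : Type*} [CommRing R] {a : F} (ha : a ≠ 0) (t : K) :
    ∑ x : F, (if τ (a * x) = t then (1 : R) else 0) = (Fintype.card K : R) ^ n := by
  have := card_fiber_linearForm hF (comp_mulLeft_ne_zero hτ ha) t
  rw [Finset.sum_boole, ← Nat.cast_pow, ← this]
  rfl

/-- The excess of squares over non-squares on the affine hyperplane `τ (a * x) = t`. -/
def sqBias (τ : F →ₗ[K] K) (a : F) (t : K) : ℤ :=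
  ∑ x : F, if τ (a * x) = t then quadraticChar F x else 0

theorem quadraticChar_sq_eq_one {x : F} (hx : x ≠ 0) :
    quadraticChar F x * quadraticChar F x = 1 := by
  rw [← sq]; exact quadraticChar_sq_one hx

theorem sqBias_mul (τ : F →ₗ[K] K) {r : F} (hr : r ≠ 0) (a : F) (t : K) :
    sqBias τ (r * a) t = quadraticChar F r * sqBias τ a t := by
  unfold sqBias
  rw [mul_sum, ← Equiv.sum_comp (Equiv.mulLeft₀ r hr) (fun x =>
    quadraticChar F r * if τ (a * x) = t then quadraticChar F x else 0)]
  refine sum_congr rfl fun x _ => ?_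
  have e : r * a * x = a * (r * x) := by ring
  have e' : (Equiv.mulLeft₀ r hr) x = r * x := rfl
  simp only [e', e, map_mul]
  split_ifs
  · rw [← mul_assoc, quadraticChar_sq_eq_one hr, one_mul]
  · rw [mul_zero]

/-- Scaling `t` by `k` amounts to scaling `a` by the inverse of `k`, because `τ` is `K`-linear. -/
theorem sqBias_smul (τ : F →ₗ[K] K) {k : K} (hk : k ≠ 0) (a : F) (t : K) :
    sqBias τ a (k * t) = quadraticChar F (algebraMap K F k) * sqBias τ a t := by
  have hr : algebraMap K F k ≠ 0 := by simpa using hk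
  have h := sqBias_mul τ hr a (k * t)
  have h2 : sqBias τ (algebraMap K F k * a) (k * t) = sqBias τ a t := by
    unfold sqBias
    refine sum_congr rfl fun x _ => ?_
    have e : τ (algebraMap K F k * a * x) = k * τ (a * x) := by
      rw [mul_assoc, ← Algebra.smul_def, map_smul, smul_eq_mul]
    simp only [e, mul_right_inj' hk]
  rw [← h2, h, ← mul_assoc, quadraticChar_sq_eq_one hr, one_mul]

theorem sum_sqBias (h2 : ringChar F ≠ 2) (τ : F →ₗ[K] K) (a : F) :
    ∑ t, sqBias τ a t = 0 := by
  unfold sqBias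
  rw [sum_comm]
  simpa using quadraticChar_sum_zero h2

/-- The sum runs over pairs `(x, y)` with `τ (a x) = τ (a y)`. For `y ≠ 0` put `x = s y`: the
summand becomes the character of `s`, and the condition becomes `τ (a (s - 1) y) = 0`. The number of
such `y ≠ 0` is the same for all `s ≠ 1`, so, the character having sum zero, only the excess at `s =
1` survives. -/
theorem sum_sqBias_sq {n : ℕ} (hF : Fintype.card F = Fintype.card K ^ (n + 1))
    (h2 : ringChar F ≠ 2) {τ : F →ₗ[K] K} (hτ : τ ≠ 0) {a : F} (ha : a ≠ 0) :
    ∑ t, sqBias τ a t ^ 2 = (Fintype.card K : ℤ) ^ (n + 1) - (Fintype.card K : ℤ) ^ n := by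
  have step1 : ∑ t, sqBias τ a t ^ 2 =
      ∑ y : F, ∑ x : F, if τ (a * x) = τ (a * y) then quadraticChar F x * quadraticChar F y
        else 0 := by
    have : ∀ t, sqBias τ a t ^ 2 = ∑ y : F, ∑ x : F,
        if τ (a * y) = t then (if τ (a * x) = τ (a * y) then
          quadraticChar F x * quadraticChar F y else 0) else 0 := by
      intro t
      rw [sq, sqBias, sum_mul_sum, sum_comm]
      refine sum_congr rfl fun y _ => sum_congr rfl fun x _ => ?_
      by_cases hy : τ (a * y) = t
      · subst hy; simp
      · simp [hy]
    simp only [this]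
    rw [sum_comm]
    refine sum_congr rfl fun y _ => ?_
    rw [sum_comm]
    refine sum_congr rfl fun x _ => ?_
    simp
  -- Subtracting the indicator of `y = 0` makes both sides vanish there, so that the sum can run
  -- over all `y`.
  have step2 : ∀ y : F, (∑ x : F, if τ (a * x) = τ (a * y) then
      quadraticChar F x * quadraticChar F y else 0) =
      ∑ s : F, quadraticChar F s * ((if τ ((a * (s - 1)) * y) = 0 then 1 else 0) -
        if y = 0 then 1 else 0) := by
    intro y
    by_cases hy : y = 0
    · subst hy; simp
    · rw [← Equiv.sum_comp (Equiv.mulRight₀ y hy)]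
      refine sum_congr rfl fun s _ => ?_
      have e : τ (a * (s * y)) = τ (a * y) ↔ τ ((a * (s - 1)) * y) = 0 := by
        rw [← sub_eq_zero, ← map_sub]
        have : a * (s * y) - a * y = a * (s - 1) * y := by ring
        rw [this]
      have e' : (Equiv.mulRight₀ y hy) s = s * y := rfl
      simp only [e', e, map_mul, hy, if_false, sub_zero]
      split_ifs
      · rw [mul_assoc, quadraticChar_sq_eq_one hy]
      · rw [mul_zero]
  have step3 : ∀ s : F, ∑ y : F, quadraticChar F s *
      ((if τ ((a * (s - 1)) * y) = 0 then (1 : ℤ) else 0) - if y = 0 then 1 else 0) =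
      quadraticChar F s * ((Fintype.card K : ℤ) ^ n - 1) + if s = 1 then
        ((Fintype.card K : ℤ) ^ (n + 1) - (Fintype.card K : ℤ) ^ n) else 0 := by
    intro s
    rw [← mul_sum, sum_sub_distrib]
    by_cases hs : s = 1
    · subst hs
      simp [hF]
    · rw [sum_indicator_form hF hτ (mul_ne_zero ha (sub_ne_zero.2 hs))]
      simp [hs]
  rw [step1, sum_congr rfl (fun y _ => step2 y), sum_comm, sum_congr rfl (fun s _ => step3 s),
    sum_add_distrib, ← sum_mul, quadraticChar_sum_zero h2]
  simp

/-- Euler's criterion in both fields: `(Q^m - 1)/2` is `(Q - 1)/2` times `1 + Q + ... + Q^(m-1)`,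
and Frobenius fixes `k`, so each of the `m` terms contributes one factor `k^((Q-1)/2)`. -/
theorem quadraticChar_algebraMap {m : ℕ} (hF : Fintype.card F = Fintype.card K ^ m)
    (h2 : ringChar K ≠ 2) {k : K} (hk : k ≠ 0) :
    quadraticChar F (algebraMap K F k) = quadraticChar K k ^ m := by
  have hF2 : ringChar F ≠ 2 := ringChar_algebra_ne_two h2
  have hr : algebraMap K F k ≠ 0 := by simpa using hk
  have hodd : Fintype.card K % 2 = 1 := FiniteField.odd_card_of_char_ne_two h2
  have hpos : ∀ j : ℕ, Fintype.card K ^ j % 2 = 1 := fun j => by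
    rw [Nat.pow_mod, hodd, one_pow, Nat.one_mod]
  have key : ∀ j : ℕ, k ^ (Fintype.card K ^ j / 2) = (k ^ (Fintype.card K / 2)) ^ j := by
    intro j
    induction j with
    | zero => simp
    | succ j ih =>
      have e : Fintype.card K ^ (j + 1) / 2 =
          Fintype.card K * (Fintype.card K ^ j / 2) + Fintype.card K / 2 := by
        have h1 := Nat.div_add_mod (Fintype.card K ^ j) 2
        have h3 := Nat.div_add_mod (Fintype.card K) 2
        have h4 := Nat.div_add_mod (Fintype.card K ^ (j + 1)) 2
        rw [hpos] at h1 h4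
        rw [hodd] at h3
        have h5 : Fintype.card K ^ (j + 1) = Fintype.card K * Fintype.card K ^ j := pow_succ' _ _
        rw [← h1, mul_add, mul_one] at h5
        have : Fintype.card K * (2 * (Fintype.card K ^ j / 2)) =
          2 * (Fintype.card K * (Fintype.card K ^ j / 2)) := by ring
        omega
      rw [e, pow_add, pow_mul, FiniteField.pow_card, ih, pow_succ]
  have hone : (1 : F) ≠ -1 := (Ring.neg_one_ne_one_of_char_ne_two hF2).symm
  have inj : ∀ u v : ℤ, (u = 1 ∨ u = -1) → (v = 1 ∨ v = -1) → (u : F) = v → u = v := by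
    rintro u v (rfl | rfl) (rfl | rfl) h
    · rfl
    · exact absurd (by simpa using h) hone
    · exact absurd (by simpa using h.symm) hone
    · rfl
  apply inj
  · exact quadraticChar_dichotomy hr
  · rcases quadraticChar_dichotomy hk with h | h <;> rw [h]
    · simp
    · exact neg_one_pow_eq_or ℤ m
  · rw [quadraticChar_eq_pow_of_char_ne_two' hF2, hF, ← map_pow, key, map_pow, Int.cast_pow]
    congr 1
    rw [← quadraticChar_eq_pow_of_char_ne_two' h2]
    simp

/-- In odd degree the bias is a multiple of the quadratic character of `K`. -/
theorem sqBias_of_odd {j : ℕ} (hF : Fintype.card F = Fintype.card K ^ (2 * j + 1))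
    (h2 : ringChar K ≠ 2) {τ : F →ₗ[K] K} (hτ : τ ≠ 0) {a : F} (ha : a ≠ 0) :
    ∃ e : ℤ, (e = (Fintype.card K : ℤ) ^ j ∨ e = -(Fintype.card K : ℤ) ^ j) ∧
      ∀ t, sqBias τ a t = quadraticChar K t * e := by
  have hF2 : ringChar F ≠ 2 := ringChar_algebra_ne_two h2
  have hχ : ∀ k : K, k ≠ 0 → quadraticChar F (algebraMap K F k) = quadraticChar K k := by
    intro k hk
    rw [quadraticChar_algebraMap hF h2 hk, pow_succ, pow_mul, quadraticChar_sq_one hk]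
    simp
  -- Scaling `t = 0` by a non-square of `K` changes the sign of the bias but not `t`.
  have h0 : sqBias τ a 0 = 0 := by
    obtain ⟨k, hk⟩ := quadraticChar_exists_neg_one h2
    have hk0 : k ≠ 0 := by rintro rfl; simp at hk
    have := sqBias_smul τ hk0 a 0
    rw [mul_zero, hχ k hk0, hk] at this
    linarith
  have hd : ∀ t, sqBias τ a t = quadraticChar K t * sqBias τ a 1 := by
    intro t
    by_cases ht : t = 0
    · subst ht; simp [h0]
    · have := sqBias_smul τ ht a 1
      rwa [mul_one, hχ t ht] at this
  refine ⟨sqBias τ a 1, ?_, hd⟩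
  have hs := sum_sqBias_sq hF hF2 hτ ha
  have hterm : ∀ t : K, sqBias τ a t ^ 2 = (1 - if t = 0 then 1 else 0) * sqBias τ a 1 ^ 2 := by
    intro t
    rw [hd t, mul_pow]
    by_cases ht : t = 0
    · subst ht; simp
    · rw [quadraticChar_sq_one ht]; simp [ht]
  rw [sum_congr rfl (fun t _ => hterm t), ← sum_mul, sum_sub_distrib] at hs
  simp only [sum_const, card_univ, sum_ite_eq', mem_univ, if_true, nsmul_eq_mul, mul_one] at hs
  have hQ : (1 : ℤ) < Fintype.card K := by exact_mod_cast Fintype.one_lt_card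
  -- The `Q - 1` nonzero values of `t` contribute equally to the second moment, which fixes the
  -- absolute value.
  have h3 : ((Fintype.card K : ℤ) - 1) * sqBias τ a 1 ^ 2 =
      ((Fintype.card K : ℤ) - 1) * ((Fintype.card K : ℤ) ^ j) ^ 2 := by
    rw [hs]; ring
  exact sq_eq_sq_iff_eq_or_eq_neg.1 (mul_left_cancel₀ (by linarith) h3)

/-- In even degree the bias takes two values. -/
theorem sqBias_of_even {j : ℕ} (hF : Fintype.card F = Fintype.card K ^ (2 * j + 2))
    (h2 : ringChar K ≠ 2) {τ : F →ₗ[K] K} (hτ : τ ≠ 0) :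
    ∃ e : ℤ, (e = (Fintype.card K : ℤ) ^ j ∨ e = -(Fintype.card K : ℤ) ^ j) ∧
      ∀ a, a ≠ 0 → sqBias τ a 0 = quadraticChar F a * ((Fintype.card K - 1) * e) ∧
        ∀ t, t ≠ 0 → sqBias τ a t = -(quadraticChar F a * e) := by
  have hF2 : ringChar F ≠ 2 := ringChar_algebra_ne_two h2
  have hd : ∀ t, t ≠ 0 → sqBias τ 1 t = sqBias τ 1 1 := by
    intro t ht
    have := sqBias_smul τ ht 1 1
    rwa [mul_one, quadraticChar_algebraMap hF h2 ht, show 2 * j + 2 = 2 * (j + 1) by ring,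
      pow_mul, quadraticChar_sq_one ht, one_pow, one_mul] at this
  have hsum := sum_sqBias (K := K) hF2 τ 1
  have hs := sum_sqBias_sq hF hF2 hτ one_ne_zero
  have hterm : ∀ t : K, sqBias τ 1 t = sqBias τ 1 1 +
      if t = 0 then sqBias τ 1 0 - sqBias τ 1 1 else 0 := by
    intro t
    by_cases ht : t = 0
    · subst ht; simp
    · simp [ht, hd t ht]
  have hterm2 : ∀ t : K, sqBias τ 1 t ^ 2 = sqBias τ 1 1 ^ 2 +
      if t = 0 then sqBias τ 1 0 ^ 2 - sqBias τ 1 1 ^ 2 else 0 := by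
    intro t
    by_cases ht : t = 0
    · subst ht; simp
    · simp [ht, hd t ht]
  rw [sum_congr rfl (fun t _ => hterm t), sum_add_distrib] at hsum
  rw [sum_congr rfl (fun t _ => hterm2 t), sum_add_distrib] at hs
  simp only [sum_const, card_univ, sum_ite_eq', mem_univ, if_true, nsmul_eq_mul] at hs hsum
  have hQ : (1 : ℤ) < Fintype.card K := by exact_mod_cast Fintype.one_lt_card
  -- The total bias vanishes, so the value at `0` balances the `Q - 1` equal values elsewhere.
  have h0 : sqBias τ 1 0 = -(((Fintype.card K : ℤ) - 1) * sqBias τ 1 1) := by linarith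
  rw [h0] at hs
  have h3 : (((Fintype.card K : ℤ) - 1) * Fintype.card K) * sqBias τ 1 1 ^ 2 =
      (((Fintype.card K : ℤ) - 1) * Fintype.card K) * ((Fintype.card K : ℤ) ^ j) ^ 2 := by
    have : (Fintype.card K : ℤ) ^ (2 * j + 1 + 1) - (Fintype.card K : ℤ) ^ (2 * j + 1) =
      (((Fintype.card K : ℤ) - 1) * Fintype.card K) * ((Fintype.card K : ℤ) ^ j) ^ 2 := by ring
    rw [← this, ← hs]; ring
  have h4 := sq_eq_sq_iff_eq_or_eq_neg.1
    (mul_left_cancel₀ (mul_ne_zero (by linarith) (by linarith)) h3)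
  refine ⟨-sqBias τ 1 1, ?_, ?_⟩
  · rcases h4 with h | h <;> rw [h] <;> simp
  · intro a ha
    have hm : ∀ t, sqBias τ a t = quadraticChar F a * sqBias τ 1 t := by
      intro t
      have := sqBias_mul τ ha 1 t
      rwa [mul_one] at this
    refine ⟨by rw [hm, h0]; ring, fun t ht => by rw [hm, hd t ht]; ring⟩

/-- The indicator of the squares is `(1 + χ(x) + [x = 0]) / 2`; the last term corrects for `0`,
which counts as a square. -/
theorem sum_isSquare {R : Type*} [Field R] [CharZero R] (f : F → R) :
    ∑ x : {x : F // IsSquare x}, f x =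
      ∑ x : F, f x * ((1 + (quadraticChar F x : R) + if x = 0 then 1 else 0) / 2) := by
  rw [← Finset.sum_subtype (s := univ.filter fun x : F => IsSquare x) (by simp) f, sum_filter]
  refine sum_congr rfl fun x _ => ?_
  by_cases hx : x = 0
  · subst hx; simp
  · by_cases hs : IsSquare x
    · have := (quadraticChar_one_iff_isSquare hx).2 hs
      simp [hx, hs, this]
    · have := quadraticChar_neg_one_iff_not_isSquare.2 hs
      simp [hx, hs, this]

theorem two_mul_card_isSquare (h2 : ringChar F ≠ 2) :
    2 * Fintype.card {x : F // IsSquare x} = Fintype.card F + 1 := by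
  have h := sum_isSquare (F := F) (R := ℚ) (fun _ => 1)
  have h0 : (∑ x : F, (quadraticChar F x : ℚ)) = 0 := by
    exact_mod_cast quadraticChar_sum_zero h2
  simp only [one_mul, ← sum_div, sum_add_distrib, h0] at h
  simp at h
  have : (2 * Fintype.card {x : F // IsSquare x} : ℚ) = Fintype.card F + 1 := by
    rw [h]; ring
  exact_mod_cast this

theorem sum_isSquare_indicator {n : ℕ} (hF : Fintype.card F = Fintype.card K ^ (n + 1))
    {τ : F →ₗ[K] K} (hτ : τ ≠ 0) {a : F} (ha : a ≠ 0) (t : K) :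
    ∑ x : {x : F // IsSquare x}, (if τ (a * x) = t then (1 : ℚ) else 0) =
      ((Fintype.card K : ℚ) ^ n + sqBias τ a t + if t = 0 then 1 else 0) / 2 := by
  rw [sum_isSquare (fun x => if τ (a * x) = t then (1 : ℚ) else 0),
    ← sum_indicator_form hF hτ ha t, sqBias]
  have h0 : (∑ x : F, if x = 0 then (if τ (a * x) = t then (1 : ℚ) else 0) else 0) =
      if t = 0 then 1 else 0 := by
    simp [eq_comm]
  rw [← h0, Int.cast_sum, ← sum_add_distrib, ← sum_add_distrib, sum_div]
  refine sum_congr rfl fun x _ => ?_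
  by_cases h : τ (a * x) = t <;> simp [h]

end CharacterSums

/-! ### Linear forms, subfield codes, duality and sphere packing -/

section LinearCodes

theorem isMinDist_of_weights {K ι : Type*} [Field K] [DecidableEq K] [Fintype ι]
    {C : Submodule K (ι → K)} {d : ℕ} (hle : ∀ c ∈ C, c ≠ 0 → d ≤ hammingNorm c)
    (hex : ∃ c ∈ C, c ≠ 0 ∧ hammingNorm c = d) : IsMinDist C d := by
  constructor
  · obtain ⟨c, hc, h0, hd⟩ := hex
    exact ⟨c, hc, 0, C.zero_mem, h0, by rw [hammingDist_zero_right, hd]⟩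
  · rintro e ⟨x, hx, y, hy, hxy, rfl⟩
    rw [hammingDist_eq_hammingNorm]
    exact hle _ (C.add_mem (C.neg_mem hx) hy) fun h => hxy (neg_add_eq_zero.1 h)

theorem weight_ge_of_isMinDist {K ι : Type*} [Field K] [DecidableEq K] [Fintype ι]
    {C : Submodule K (ι → K)} {d : ℕ} (h : IsMinDist C d) {c : ι → K} (hc : c ∈ C)
    (h0 : c ≠ 0) : d ≤ hammingNorm c :=
  h.2 ⟨c, hc, 0, C.zero_mem, h0, hammingDist_zero_right c⟩

/-- The pairing `(a, x) ↦ τ (a x)` is nondegenerate, and `F` has the dimension of its dual. This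
stands in for the trace form. -/
theorem exists_eq_mul_of_linearForm {K F : Type*} [Field K] [Field F] [Algebra K F]
    [FiniteDimensional K F] {τ : F →ₗ[K] K} (hτ : τ ≠ 0) (φ : F →ₗ[K] K) :
    ∃ a : F, ∀ x, φ x = τ (a * x) := by
  let Φ : F →ₗ[K] Module.Dual K F := (LinearMap.llcomp K F F K τ) ∘ₗ (LinearMap.mul K F)
  have hΦ : ∀ a x, Φ a x = τ (a * x) := fun a x => rfl
  have hinj : Function.Injective Φ := by
    rw [injective_iff_map_eq_zero]
    intro a ha
    by_contra h
    exact comp_mulLeft_ne_zero hτ h (by ext x; exact LinearMap.congr_fun ha x)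
  obtain ⟨a, ha⟩ := (LinearMap.injective_iff_surjective_of_finrank_eq_finrank
    (Subspace.dual_finrank_eq (K := K) (V := F)).symm).1 hinj φ
  exact ⟨a, fun x => by rw [← ha, hΦ]⟩

/-- The subfield code is the image of the code under any non-zero linear form. -/
theorem mem_subfieldCode_iff {K F κ ι β : Type*} [Field K] [Field F] [Algebra K F] [Fintype β]
    (B : Module.Basis β K F) (G : Matrix κ ι F) {τ : F →ₗ[K] K} (hτ : τ ≠ 0) (w : ι → K) :
    w ∈ subfieldCode B G ↔ ∃ c ∈ rowCode G, w = fun j => τ (c j) := by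
  have : FiniteDimensional K F := B.finiteDimensional_of_finite
  constructor
  · intro hw
    suffices h : subfieldCode B G ≤
        ((rowCode G).restrictScalars K).map (τ.compLeft ι) by
      obtain ⟨c, hc, rfl⟩ := h hw
      exact ⟨c, hc, rfl⟩
    refine Submodule.span_le.2 ?_
    rintro _ ⟨⟨i, b⟩, rfl⟩
    obtain ⟨a, ha⟩ := exists_eq_mul_of_linearForm hτ (B.coord b)
    refine ⟨a • G i, Submodule.smul_mem _ _ (Submodule.subset_span (Set.mem_range_self i)), ?_⟩
    ext j
    exact (ha (G i j)).symm
  · rintro ⟨c, hc, rfl⟩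
    -- The extra factor `a` makes the claim stable under `F`-scalars, as the induction over the
    -- `F`-span requires.
    suffices h : ∀ a : F, (fun j => τ (a * c j)) ∈ subfieldCode B G by simpa using h 1
    refine Submodule.span_induction (p := fun c _ => ∀ a : F,
      (fun j => τ (a * c j)) ∈ subfieldCode B G) ?_ ?_ ?_ ?_ hc
    · rintro _ ⟨i, rfl⟩ a
      have e : (fun j => τ (a * G i j)) = ∑ b, τ (a * B b) • expandMatrix B G (i, b) := by
        ext j
        simp only [Finset.sum_apply, Pi.smul_apply, expandMatrix, smul_eq_mul]
        conv_lhs => rw [← B.sum_repr (G i j), Finset.mul_sum, map_sum]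
        refine Finset.sum_congr rfl fun b _ => ?_
        rw [mul_smul_comm, map_smul, smul_eq_mul, mul_comm]
      change (fun j => τ (a * G i j)) ∈ _
      rw [e]
      exact Submodule.sum_mem _ fun b _ =>
        Submodule.smul_mem _ _ (Submodule.subset_span ⟨(i, b), rfl⟩)
    · intro a
      simp only [Pi.zero_apply, mul_zero, map_zero]
      exact Submodule.zero_mem _
    · intro x y _ _ hx hy a
      simp only [Pi.add_apply, mul_add, map_add]
      exact Submodule.add_mem _ (hx a) (hy a)
    · intro r x _ hx a
      simp only [Pi.smul_apply, smul_eq_mul, ← mul_assoc]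
      exact hx (a * r)

theorem finrank_dualCode {K ι : Type*} [Field K] [Fintype ι] (C : Submodule K (ι → K)) :
    Module.finrank K (dualCode C) + Module.finrank K C = Fintype.card ι := by
  classical
  have h : (dualCode C).map (dotProductEquiv K ι : (ι → K) →ₗ[K] Module.Dual K (ι → K)) =
      C.dualAnnihilator := by
    ext φ
    rw [Submodule.mem_map, Submodule.mem_dualAnnihilator]
    constructor
    · rintro ⟨v, hv, rfl⟩ c hc
      exact hv c hc
    · intro hφ
      obtain ⟨v, rfl⟩ := (dotProductEquiv K ι).surjective φ
      exact ⟨v, fun c hc => hφ c hc, rfl⟩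
  rw [← LinearEquiv.finrank_map_eq (dotProductEquiv K ι) (dualCode C), h, add_comm,
    Subspace.finrank_add_finrank_dualAnnihilator_eq, Module.finrank_fintype_fun_eq_card]

theorem hammingNorm_single_le {K ι : Type*} [Field K] [DecidableEq K] [Fintype ι] [DecidableEq ι]
    (i : ι) (x : K) : hammingNorm (Pi.single i x : ι → K) ≤ 1 := by
  rw [hammingNorm, Finset.card_le_one]
  intro a ha b hb
  simp only [Finset.mem_filter, Finset.mem_univ, true_and] at ha hb
  have h1 : a = i := by by_contra h; exact ha (Pi.single_eq_of_ne h _)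
  have h2 : b = i := by by_contra h; exact hb (Pi.single_eq_of_ne h _)
  rw [h1, h2]

/-- Balls of radius one around the codewords are disjoint. A ball is indexed by `Option (ι × Kˣ)`:
no error, or a nonzero error at one position. -/
theorem hammingBound_radius_one {K ι : Type*} [Field K] [Fintype K] [DecidableEq K] [Fintype ι]
    (D : Submodule K (ι → K)) (hD : ∀ c ∈ D, c ≠ 0 → 3 ≤ hammingNorm c) :
    Fintype.card K ^ Module.finrank K D * (1 + (Fintype.card K - 1) * Fintype.card ι) ≤
      Fintype.card K ^ Fintype.card ι := by
  classical
  let g : Option (ι × Kˣ) → (ι → K) := fun o => o.elim 0 fun z => Pi.single z.1 (z.2 : K)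
  have hg : ∀ o, hammingNorm (g o) ≤ 1 := by
    rintro (_ | ⟨i, x⟩)
    · simp [g]
    · exact hammingNorm_single_le i (x : K)
  have ginj : Function.Injective g := by
    rintro (_ | ⟨i, x⟩) (_ | ⟨j, y⟩) h
    · rfl
    · exact absurd (congrFun h j).symm (by simp [g])
    · exact absurd (congrFun h i) (by simp [g])
    · have hij : i = j := by
        by_contra hne
        have := congrFun h i
        simp [g, Pi.single_eq_of_ne hne] at this
      subst hij
      have := congrFun h i
      simp only [g, Option.elim, Pi.single_eq_same] at this
      rw [Units.ext this]
  have inj : Function.Injective fun z : D × Option (ι × Kˣ) => (z.1 : ι → K) + g z.2 := by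
    rintro ⟨c, o⟩ ⟨c', o'⟩ h
    simp only at h
    have hcc : (c : ι → K) - (c' : ι → K) = g o' - g o := by
      rw [sub_eq_sub_iff_add_eq_add, h, add_comm]
    have hlt : hammingNorm ((c : ι → K) - (c' : ι → K)) ≤ 2 := by
      rw [hcc, sub_eq_neg_add, ← hammingDist_eq_hammingNorm]
      refine (hammingDist_triangle_right _ _ 0).trans ?_
      rw [hammingDist_zero_right, hammingDist_zero_right]
      exact add_le_add (hg _) (hg _)
    have h0 : (c : ι → K) - (c' : ι → K) = 0 := by
      by_contra hne
      have := hD _ (D.sub_mem c.2 c'.2) hne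
      omega
    have hc : c = c' := Subtype.ext (sub_eq_zero.1 h0)
    subst hc
    rw [ginj (add_left_cancel h)]
  have hcard := Fintype.card_le_of_injective _ inj
  rw [Fintype.card_prod, Fintype.card_option, Fintype.card_prod, Fintype.card_units,
    Module.card_eq_pow_finrank (K := K) (V := D), Fintype.card_fun] at hcard
  rwa [add_comm 1, mul_comm (Fintype.card K - 1)]

end LinearCodes

/-! ### The trace code: dimension, dual and weights -/

section TraceCode

open Finset

set_option linter.unusedSectionVars false

variable {K F : Type*} [Field K] [Fintype K] [DecidableEq K] [Field F] [Fintype F]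
  [DecidableEq F] [Algebra K F]

/-- The codeword `(τ (a x + b y) + c, τ a, τ b)`. -/
def traceWord {K F : Type*} [Field K] [Field F] [Algebra K F] (τ : F →ₗ[K] K) :
    (F × F × K) →ₗ[K] (Pos F → K) where
  toFun v := Sum.elim (fun z => τ (v.1 * z.1) + τ (v.2.1 * z.2) + v.2.2) ![τ v.1, τ v.2.1]
  map_add' v w := by
    ext j
    rcases j with ⟨x, y⟩ | t
    · simp only [Sum.elim_inl, Prod.fst_add, Prod.snd_add, add_mul, map_add, Pi.add_apply]
      ring
    · fin_cases t <;> simp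
  map_smul' r v := by
    ext j
    rcases j with ⟨x, y⟩ | t
    · simp only [Sum.elim_inl, Prod.smul_fst, Prod.smul_snd, smul_mul_assoc, map_smul,
        Pi.smul_apply, smul_eq_mul, RingHom.id_apply]
      ring
    · fin_cases t <;> simp

theorem traceWord_inl (τ : F →ₗ[K] K) (v : F × F × K) (x : {x : F // IsSquare x}) (y : F) :
    traceWord τ v (Sum.inl (x, y)) = τ (v.1 * x) + τ (v.2.1 * y) + v.2.2 := rfl

theorem traceWord_inr_zero (τ : F →ₗ[K] K) (v : F × F × K) :
    traceWord τ v (Sum.inr 0) = τ v.1 := rfl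

theorem traceWord_inr_one (τ : F →ₗ[K] K) (v : F × F × K) :
    traceWord τ v (Sum.inr 1) = τ v.2.1 := rfl

theorem subfieldCode_eq_range {κ β : Type*} [Fintype β] (B : Module.Basis β K F)
    (G : Matrix κ (Pos F) F) (hG : rowCode G = codeC1 F) {τ : F →ₗ[K] K} (hτ : τ ≠ 0) :
    subfieldCode B G = LinearMap.range (traceWord τ) := by
  ext w
  rw [mem_subfieldCode_iff B G hτ, hG, LinearMap.mem_range]
  have hmem : ∀ c : Pos F → F, c ∈ codeC1 F ↔ ∃ l : Fin 3 → F, ∑ i, l i • matG1 F i = c :=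
    fun c => Submodule.mem_span_range_iff_exists_fun F
  constructor
  · rintro ⟨c, hc, rfl⟩
    obtain ⟨l, rfl⟩ := (hmem c).1 hc
    refine ⟨(l 0, l 1, τ (l 2)), ?_⟩
    ext j
    rcases j with ⟨x, y⟩ | t
    · simp [traceWord, Fin.sum_univ_three, matG1]
    · fin_cases t <;> simp [traceWord, Fin.sum_univ_three, matG1]
  · rintro ⟨⟨a, b, c⟩, rfl⟩
    obtain ⟨d, rfl⟩ := LinearMap.surjective hτ c
    refine ⟨_, (hmem _).2 ⟨![a, b, d], rfl⟩, ?_⟩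
    ext j
    rcases j with ⟨x, y⟩ | t
    · simp [traceWord, Fin.sum_univ_three, matG1]
    · fin_cases t <;> simp [traceWord, Fin.sum_univ_three, matG1]

theorem eq_zero_of_forall_mul {τ : F →ₗ[K] K} (hτ : τ ≠ 0) {a : F}
    (h : ∀ x, τ (a * x) = 0) : a = 0 := by
  by_contra ha
  exact comp_mulLeft_ne_zero hτ ha (LinearMap.ext h)

theorem exists_mul_ne_zero {τ : F →ₗ[K] K} (hτ : τ ≠ 0) {z : F} (hz : z ≠ 0) :
    ∃ a, τ (a * z) ≠ 0 := by
  by_contra! h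
  exact hz (eq_zero_of_forall_mul hτ fun x => by rw [mul_comm]; exact h x)

/-- The coordinates at `(0, 0)`, `(0, y)` and `(x, 0)` recover `c`, `b` and `a` in turn. Squares
suffice for `a` because every element is a difference of two squares. -/
theorem traceWord_injective (h2 : ringChar K ≠ 2) {τ : F →ₗ[K] K} (hτ : τ ≠ 0) :
    Function.Injective (traceWord τ) := by
  have hF2 : (2 : F) ≠ 0 := Ring.two_ne_zero (ringChar_algebra_ne_two h2)
  rw [injective_iff_map_eq_zero]
  rintro ⟨a, b, c⟩ h
  have hinl : ∀ (x : F) (_ : IsSquare x) (y : F), τ (a * x) + τ (b * y) + c = 0 :=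
    fun x hx y => congrFun h (Sum.inl (⟨x, hx⟩, y))
  have hc : c = 0 := by simpa using hinl 0 IsSquare.zero 0
  subst hc
  have hb : b = 0 := eq_zero_of_forall_mul hτ fun y => by simpa using hinl 0 IsSquare.zero y
  have ha : a = 0 := by
    refine eq_zero_of_forall_mul hτ fun x => ?_
    have hx : a * x = a * ((x + 1) / 2 * ((x + 1) / 2)) - a * ((x - 1) / 2 * ((x - 1) / 2)) := by
      field_simp; ring
    have h1 := hinl _ ⟨(x + 1) / 2, rfl⟩ 0
    have h3 := hinl _ ⟨(x - 1) / 2, rfl⟩ 0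
    simp only [mul_zero, map_zero, add_zero] at h1 h3
    rw [hx, map_sub, h1, h3, sub_zero]
  rw [ha, hb]; rfl

theorem finrank_range_traceWord (h2 : ringChar K ≠ 2) {τ : F →ₗ[K] K} (hτ : τ ≠ 0) :
    Module.finrank K (LinearMap.range (traceWord τ)) = 2 * Module.finrank K F + 1 := by
  rw [LinearMap.finrank_range_of_inj (traceWord_injective h2 hτ), Module.finrank_prod,
    Module.finrank_prod, Module.finrank_self]
  ring

theorem two_mul_card_pos (h2 : ringChar F ≠ 2) :
    2 * Fintype.card (Pos F) = Fintype.card F ^ 2 + Fintype.card F + 4 := by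
  have := two_mul_card_isSquare h2
  rw [Fintype.card_sum, Fintype.card_prod, Fintype.card_fin, mul_add, ← mul_assoc, this]
  ring

/-! ### The dual of the trace code -/

/-- A word of weight at most 2 lives on two positions `i`, `j` with `w i ≠ 0`; pairing it with a
codeword that vanishes at `j` but not at `i` gives a nonzero product. -/
theorem three_le_weight_dualCode {K ι : Type*} [Field K] [DecidableEq K] [Fintype ι]
    [Nontrivial ι] {C : Submodule K (ι → K)}
    (hC : ∀ i j, i ≠ j → ∃ c ∈ C, c i ≠ 0 ∧ c j = 0) {w : ι → K} (hw : w ∈ dualCode C)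
    (h0 : w ≠ 0) : 3 ≤ hammingNorm w := by
  classical
  by_contra! hlt
  obtain ⟨i, hi⟩ := Function.ne_iff.1 h0
  have hiS : i ∈ univ.filter fun k => w k ≠ 0 := by simpa using hi
  have hcard : #((univ.filter fun k => w k ≠ 0).erase i) ≤ 1 := by
    rw [card_erase_of_mem hiS]
    have : #(univ.filter fun k => w k ≠ 0) < 3 := hlt
    omega
  obtain ⟨j, hij, hj⟩ : ∃ j, i ≠ j ∧ ∀ k, k ≠ i → k ≠ j → w k = 0 := by
    by_cases hex : ∃ j, j ≠ i ∧ w j ≠ 0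
    · obtain ⟨j, hji, hwj⟩ := hex
      refine ⟨j, hji.symm, fun k hki hkj => ?_⟩
      by_contra hwk
      exact hkj (card_le_one.1 hcard k (by simp [hki, hwk]) j (by simp [hji, hwj]))
    -- In weight one any other position serves as `j`.
    · push Not at hex
      obtain ⟨j, hj⟩ := exists_ne i
      exact ⟨j, hj.symm, fun k hki _ => hex k hki⟩
  obtain ⟨c, hc, hci, hcj⟩ := hC i j hij
  have hdot := hw c hc
  rw [dotProduct, sum_eq_single i] at hdot
  · exact (mul_ne_zero hi hci) hdot
  · intro k _ hki
    by_cases hkj : k = j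
    · rw [hkj, hcj, mul_zero]
    · rw [hj k hki hkj, zero_mul]
  · intro h; exact absurd (mem_univ i) h

theorem traceWord_separates {τ : F →ₗ[K] K} (hτ : τ ≠ 0) (i j : Pos F) (hij : i ≠ j) :
    ∃ v, traceWord τ v i ≠ 0 ∧ traceWord τ v j = 0 := by
  obtain ⟨t, ht⟩ : ∃ t, τ t ≠ 0 := by simpa using exists_mul_ne_zero hτ one_ne_zero
  rcases i with ⟨x, y⟩ | i <;> rcases j with ⟨x', y'⟩ | j
  · by_cases hx : x = x'
    · have hy : y - y' ≠ 0 := by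
        rw [sub_ne_zero]; rintro rfl; exact hij (by rw [hx])
      obtain ⟨b, hb⟩ := exists_mul_ne_zero hτ hy
      refine ⟨(0, b, -τ (b * y')), ?_, ?_⟩
      · rw [mul_sub, map_sub] at hb
        simpa [traceWord_inl, ← sub_eq_add_neg] using hb
      · simp [traceWord_inl]
    · have hx' : (x : F) - x' ≠ 0 := sub_ne_zero.2 fun h => hx (Subtype.ext h)
      obtain ⟨a, ha⟩ := exists_mul_ne_zero hτ hx'
      refine ⟨(a, 0, -τ (a * x')), ?_, ?_⟩
      · rw [mul_sub, map_sub] at ha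
        simpa [traceWord_inl, ← sub_eq_add_neg] using ha
      · simp [traceWord_inl]
  · refine ⟨(0, 0, 1), by simp [traceWord_inl], ?_⟩
    fin_cases j <;> simp [traceWord_inr_zero, traceWord_inr_one]
  · fin_cases i
    · exact ⟨(t, 0, -τ (t * x')), by simpa [traceWord_inr_zero] using ht, by simp [traceWord_inl]⟩
    · exact ⟨(0, t, -τ (t * y')), by simpa [traceWord_inr_one] using ht, by simp [traceWord_inl]⟩
  · fin_cases i <;> fin_cases j
    · exact absurd rfl hij
    · exact ⟨(t, 0, 0), by simpa [traceWord_inr_zero] using ht, by simp [traceWord_inr_one]⟩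
    · exact ⟨(0, t, 0), by simpa [traceWord_inr_one] using ht, by simp [traceWord_inr_zero]⟩
    · exact absurd rfl hij

theorem isMinDist_dualCode_range_traceWord {τ : F →ₗ[K] K} (hτ : τ ≠ 0) :
    IsMinDist (dualCode (LinearMap.range (traceWord τ))) 3 := by
  have hnt : Nontrivial (Pos F) := ⟨⟨Sum.inr 0, Sum.inr 1, by simp⟩⟩
  have hge : ∀ c ∈ dualCode (LinearMap.range (traceWord τ)), c ≠ 0 → 3 ≤ hammingNorm c := by
    intro c hc h0
    refine three_le_weight_dualCode (fun i j hij => ?_) hc h0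
    obtain ⟨v, hv⟩ := traceWord_separates hτ i j hij
    exact ⟨_, ⟨v, rfl⟩, hv⟩
  refine isMinDist_of_weights hge ?_
  let z : {x : F // IsSquare x} := ⟨0, IsSquare.zero⟩
  -- The relation `(0, 1, 1) - (0, 0, 1) - (0, 1, 0) = 0` between columns of `matG1`.
  let w : Pos F → K := Pi.single (Sum.inl (z, 1)) 1 + (Pi.single (Sum.inl (z, 0)) (-1) +
    Pi.single (Sum.inr 1) (-1))
  have hmem : w ∈ dualCode (LinearMap.range (traceWord τ)) := by
    rintro _ ⟨v, rfl⟩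
    simp only [w, add_dotProduct, single_dotProduct, traceWord_inl, traceWord_inr_one, z]
    simp
  have h0 : w ≠ 0 := by
    intro h
    have := congrFun h (Sum.inr 1)
    simp [w] at this
  have hadd : ∀ x y : Pos F → K, hammingNorm (x + y) ≤ hammingNorm x + hammingNorm y := by
    intro x y
    have := hammingDist_triangle (-x) 0 y
    simpa only [hammingDist_eq_hammingNorm, neg_neg, add_zero, neg_zero, zero_add] using this
  refine ⟨w, hmem, h0, le_antisymm ?_ (hge w hmem h0)⟩
  exact (hadd _ _).trans (add_le_add (b := 1) (d := 2) (hammingNorm_single_le _ _)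
    ((hadd _ _).trans (add_le_add (hammingNorm_single_le _ _) (hammingNorm_single_le _ _))))

/-! ### Weights -/

/-- The contribution `0` or `1` of a coordinate to the Hamming weight. -/
def nz (k : K) : ℚ := if k = 0 then 0 else 1

theorem hammingNorm_traceWord (τ : F →ₗ[K] K) (a b : F) (c : K) :
    (hammingNorm (traceWord τ (a, b, c)) : ℚ) =
      ∑ x : {x : F // IsSquare x}, ∑ y : F, nz (τ (a * x) + τ (b * y) + c) +
        (nz (τ a) + nz (τ b)) := by
  have h : ∀ w : Pos F → K, (hammingNorm w : ℚ) = ∑ j, nz (w j) := by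
    intro w
    rw [hammingNorm, card_filter, Nat.cast_sum]
    refine sum_congr rfl fun j _ => ?_
    by_cases hj : w j = 0 <;> simp [nz, hj]
  rw [h, Fintype.sum_sum_type, Fintype.sum_prod_type, Fin.sum_univ_two]
  rfl

theorem card_isSquare_eq {n : ℕ} (hF : Fintype.card F = Fintype.card K ^ (n + 1))
    (h2 : ringChar K ≠ 2) : (Fintype.card {x : F // IsSquare x} : ℚ) =
      ((Fintype.card K : ℚ) ^ (n + 1) + 1) / 2 := by
  have h := two_mul_card_isSquare (F := F) (ringChar_algebra_ne_two h2)
  rw [hF] at h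
  rw [eq_div_iff two_ne_zero, mul_comm]
  exact_mod_cast h

theorem sum_nz_add_form {n : ℕ} (hF : Fintype.card F = Fintype.card K ^ (n + 1))
    {τ : F →ₗ[K] K} (hτ : τ ≠ 0) {b : F} (hb : b ≠ 0) (s t : K) :
    ∑ y : F, nz (s + τ (b * y) + t) =
      (Fintype.card K : ℚ) ^ (n + 1) - (Fintype.card K : ℚ) ^ n := by
  have h := sum_indicator_form (R := ℚ) hF hτ hb (-s - t)
  have e : ∀ y : F, nz (s + τ (b * y) + t) = 1 - if τ (b * y) = -s - t then 1 else 0 := by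
    intro y
    have : s + τ (b * y) + t = 0 ↔ τ (b * y) = -s - t :=
      ⟨fun h => by linear_combination h, fun h => by rw [h]; ring⟩
    simp only [nz, this]
    split_ifs <;> simp
  simp only [e, sum_sub_distrib, h]
  simp [hF]

theorem weight_of_ne_zero {n : ℕ} (hF : Fintype.card F = Fintype.card K ^ (n + 1))
    (h2 : ringChar K ≠ 2) {τ : F →ₗ[K] K} (hτ : τ ≠ 0) (a : F) {b : F} (hb : b ≠ 0) (c : K) :
    (hammingNorm (traceWord τ (a, b, c)) : ℚ) =
      ((Fintype.card K : ℚ) ^ (n + 1) + 1) / 2 *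
        ((Fintype.card K : ℚ) ^ (n + 1) - (Fintype.card K : ℚ) ^ n) + (nz (τ a) + nz (τ b)) := by
  have hU := card_isSquare_eq hF h2
  rw [hammingNorm_traceWord, sum_congr rfl (fun (x : {x : F // IsSquare x}) _ =>
    sum_nz_add_form hF hτ hb (τ (a * x)) c),
    sum_const, card_univ, nsmul_eq_mul, hU]

theorem weight_zero_zero {n : ℕ} (hF : Fintype.card F = Fintype.card K ^ (n + 1))
    (h2 : ringChar K ≠ 2) (τ : F →ₗ[K] K) (c : K) :
    (hammingNorm (traceWord τ (0, 0, c)) : ℚ) =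
      ((Fintype.card K : ℚ) ^ (n + 1) + 1) / 2 * (Fintype.card K : ℚ) ^ (n + 1) * nz c := by
  have hU := card_isSquare_eq hF h2
  rw [hammingNorm_traceWord]
  simp only [zero_mul, map_zero, zero_add, sum_const, card_univ, nsmul_eq_mul, hU, hF,
    Nat.cast_pow]
  simp only [nz, if_true]
  ring

/-- The constant is `-c` so that the zeros on the pairs are the squares `x` with `τ (a x) = c`, each
repeated for all `q` values of `y`. -/
theorem weight_zero {n : ℕ} (hF : Fintype.card F = Fintype.card K ^ (n + 1))
    (h2 : ringChar K ≠ 2) {τ : F →ₗ[K] K} (hτ : τ ≠ 0) {a : F} (ha : a ≠ 0) (c : K) :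
    (hammingNorm (traceWord τ (a, 0, -c)) : ℚ) =
      (Fintype.card K : ℚ) ^ (n + 1) * ((Fintype.card K : ℚ) ^ (n + 1) - (Fintype.card K : ℚ) ^ n
        - sqBias τ a c + nz c) / 2 + nz (τ a) := by
  have hU := card_isSquare_eq hF h2
  have e : ∀ x : F, nz (τ (a * x) + -c) = 1 - if τ (a * x) = c then 1 else 0 := by
    intro x
    simp only [nz, ← sub_eq_add_neg, sub_eq_zero]
    split_ifs <;> simp
  rw [hammingNorm_traceWord]
  simp only [zero_mul, map_zero, add_zero, e, sum_const, card_univ, nsmul_eq_mul]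
  rw [← mul_sum, sum_sub_distrib, sum_isSquare_indicator hF hτ ha c]
  simp only [sum_const, card_univ, nsmul_eq_mul, hU, hF, nz, Nat.cast_pow, if_true]
  split_ifs <;> ring

end TraceCode

/-! ### Weight distribution -/

section WeightDistribution

open Finset

set_option linter.unusedSectionVars false

variable {K F : Type*} [Field K] [Fintype K] [DecidableEq K] [Field F] [Fintype F]
  [DecidableEq F] [Algebra K F]

theorem sum_split_zero {E : Type*} [AddCommMonoid E] [Fintype E] [DecidableEq E] (g : E → ℚ) :
    ∑ x, g x = g 0 + ∑ x, if x = 0 then 0 else g x := by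
  have h : ∀ x, g x = (if x = 0 then g 0 else 0) + if x = 0 then 0 else g x := by
    intro x
    by_cases hx : x = 0
    · subst hx; simp
    · simp [hx]
  conv_lhs => rw [sum_congr rfl fun x _ => h x]
  rw [sum_add_distrib]
  simp

theorem sum_indicator_zero {n : ℕ} (hF : Fintype.card F = Fintype.card K ^ (n + 1))
    {τ : F →ₗ[K] K} (hτ : τ ≠ 0) :
    ∑ x : F, (if τ x = 0 then (1 : ℚ) else 0) = (Fintype.card K : ℚ) ^ n := by
  simpa only [one_mul] using sum_indicator_form (R := ℚ) hF hτ one_ne_zero 0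

theorem sum_nz_form {n : ℕ} (hF : Fintype.card F = Fintype.card K ^ (n + 1))
    {τ : F →ₗ[K] K} (hτ : τ ≠ 0) (h : ℚ → ℚ) :
    ∑ x : F, h (nz (τ x)) = (Fintype.card K : ℚ) ^ n * h 0 +
      ((Fintype.card K : ℚ) ^ (n + 1) - (Fintype.card K : ℚ) ^ n) * h 1 := by
  have e : ∀ x : F, h (nz (τ x)) = h 1 + (if τ x = 0 then 1 else 0) * (h 0 - h 1) := by
    intro x
    by_cases hx : τ x = 0 <;> simp [nz, hx]
  simp only [e, sum_add_distrib, ← sum_mul, sum_indicator_zero hF hτ, sum_const, card_univ, hF,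
    nsmul_eq_mul, Nat.cast_pow]
  ring

theorem sum_nz_form_ne_zero {n : ℕ} (hF : Fintype.card F = Fintype.card K ^ (n + 1))
    {τ : F →ₗ[K] K} (hτ : τ ≠ 0) (h : ℚ → ℚ) :
    (∑ x : F, if x = 0 then 0 else h (nz (τ x))) = ((Fintype.card K : ℚ) ^ n - 1) * h 0 +
      ((Fintype.card K : ℚ) ^ (n + 1) - (Fintype.card K : ℚ) ^ n) * h 1 := by
  have h1 := sum_nz_form hF hτ h
  rw [sum_split_zero] at h1
  simp only [map_zero, nz, if_true] at h1 ⊢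
  linarith

theorem sum_quadraticChar_ne_zero (h2 : ringChar K ≠ 2) (H : ℤ → ℚ) :
    (∑ c : K, if c = 0 then 0 else H (quadraticChar K c)) =
      ((Fintype.card K : ℚ) - 1) / 2 * (H 1 + H (-1)) := by
  have e : ∀ c : K, (if c = 0 then 0 else H (quadraticChar K c)) =
      (1 - if c = 0 then 1 else 0) * ((H 1 + H (-1)) / 2) +
        (quadraticChar K c : ℚ) * ((H 1 - H (-1)) / 2) := by
    intro c
    by_cases hc : c = 0
    · subst hc; simp
    · rcases quadraticChar_dichotomy hc with h | h <;> rw [h] <;> simp [hc] <;> ring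
  have h0 : ∑ c : K, (quadraticChar K c : ℚ) = 0 := by exact_mod_cast quadraticChar_sum_zero h2
  rw [sum_congr rfl fun c _ => e c, sum_add_distrib, ← sum_mul, ← sum_mul, h0, sum_sub_distrib]
  simp
  ring

/-- Joint distribution of the character of `a` and the vanishing of `τ a`. On the kernel of `τ`
squares exceed non-squares by `sqBias τ 1 0`; off it the excess is the opposite, since the character
sums to zero. -/
theorem sum_quadraticChar_nz_ne_zero {n : ℕ} (hF : Fintype.card F = Fintype.card K ^ (n + 1))
    (h2 : ringChar K ≠ 2) {τ : F →ₗ[K] K} (hτ : τ ≠ 0) (H : ℤ → ℚ → ℚ) :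
    (∑ a : F, if a = 0 then 0 else H (quadraticChar F a) (nz (τ a))) =
      ((Fintype.card K : ℚ) ^ n - 1 + sqBias τ 1 0) / 2 * H 1 0 +
      ((Fintype.card K : ℚ) ^ n - 1 - sqBias τ 1 0) / 2 * H (-1) 0 +
      ((Fintype.card K : ℚ) ^ (n + 1) - (Fintype.card K : ℚ) ^ n - sqBias τ 1 0) / 2 * H 1 1 +
      ((Fintype.card K : ℚ) ^ (n + 1) - (Fintype.card K : ℚ) ^ n + sqBias τ 1 0) / 2 *
        H (-1) 1 := by
  have e : ∀ a : F, (if a = 0 then 0 else H (quadraticChar F a) (nz (τ a))) =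
      (if τ a = 0 then 1 else 0) * ((H 1 0 + H (-1) 0) / 2 - (H 1 1 + H (-1) 1) / 2) -
      (if a = 0 then 1 else 0) * ((H 1 0 + H (-1) 0) / 2) +
      (if τ a = 0 then (quadraticChar F a : ℚ) else 0) *
        ((H 1 0 - H (-1) 0) / 2 - (H 1 1 - H (-1) 1) / 2) +
      (quadraticChar F a : ℚ) * ((H 1 1 - H (-1) 1) / 2) + (H 1 1 + H (-1) 1) / 2 := by
    intro a
    by_cases ha : a = 0
    · subst ha; simp
    · by_cases ht : τ a = 0 <;> rcases quadraticChar_dichotomy ha with h | h <;> rw [h] <;>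
        simp [ha, ht, nz] <;> ring
  have h0 : ∑ a : F, (quadraticChar F a : ℚ) = 0 := by
    exact_mod_cast quadraticChar_sum_zero (ringChar_algebra_ne_two h2)
  have h1 : ∑ a : F, (if τ a = 0 then (quadraticChar F a : ℚ) else 0) = sqBias τ 1 0 := by
    simp [sqBias]
  rw [sum_congr rfl fun a _ => e a]
  simp only [sum_add_distrib, sum_sub_distrib, ← sum_mul, h0, h1, sum_indicator_zero hF hτ]
  simp [hF]
  ring

/-- Summing an arbitrary test function `f` over all weights encodes the whole distribution, with no
need to know which weights coincide. The last sum collects the words with `b = 0 ≠ a`. -/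
theorem sum_weights {n : ℕ} (hF : Fintype.card F = Fintype.card K ^ (n + 1))
    (h2 : ringChar K ≠ 2) {τ : F →ₗ[K] K} (hτ : τ ≠ 0) (f : ℚ → ℚ) {Q A q u : ℚ}
    (hQ : Q = Fintype.card K) (hA : A = Q ^ n) (hq : q = Q ^ (n + 1))
    (hu : u = (q + 1) / 2 * (q - A)) :
    ∑ v : F × F × K, f (hammingNorm (traceWord τ v)) =
      f 0 + (Q - 1) * f ((q + 1) / 2 * q) +
      Q * A * (A - 1) * f u + Q * (q - A) * (2 * A - 1) * f (u + 1) +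
      Q * (q - A) ^ 2 * f (u + 2) +
      ∑ a : F, if a = 0 then 0 else
        ∑ c : K, f (q * (q - A - sqBias τ a c + nz c) / 2 + nz (τ a)) := by
  subst hQ hA hq hu
  set Q : ℚ := (Fintype.card K : ℚ)
  simp only [Fintype.sum_prod_type]
  have hb : ∀ a : F, (∑ b : F, if b = 0 then 0 else
      ∑ c : K, f (hammingNorm (traceWord τ (a, b, c)))) =
      Q * ((Q ^ n - 1) * f ((Q ^ (n + 1) + 1) / 2 * (Q ^ (n + 1) - Q ^ n) + nz (τ a)) +
        (Q ^ (n + 1) - Q ^ n) *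
          f ((Q ^ (n + 1) + 1) / 2 * (Q ^ (n + 1) - Q ^ n) + (nz (τ a) + 1))) := by
    intro a
    have := sum_nz_form_ne_zero hF hτ (fun t => Q *
      f ((Q ^ (n + 1) + 1) / 2 * (Q ^ (n + 1) - Q ^ n) + (nz (τ a) + t)))
    rw [add_zero] at this
    rw [mul_add, mul_left_comm Q, mul_left_comm Q, ← this]
    refine sum_congr rfl fun b _ => ?_
    split_ifs with hb
    · rfl
    · rw [sum_congr rfl fun c _ => by rw [weight_of_ne_zero hF h2 hτ a hb c]]
      simp [Q]
  have h00 : ∑ c : K, f (hammingNorm (traceWord τ ((0 : F), (0 : F), c))) =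
      f 0 + (Q - 1) * f ((Q ^ (n + 1) + 1) / 2 * Q ^ (n + 1)) := by
    have e : ∀ c : K, f (hammingNorm (traceWord τ ((0 : F), (0 : F), c))) =
        f ((Q ^ (n + 1) + 1) / 2 * Q ^ (n + 1)) + if c = 0 then
          f 0 - f ((Q ^ (n + 1) + 1) / 2 * Q ^ (n + 1)) else 0 := by
      intro c
      rw [weight_zero_zero hF h2 τ c]
      by_cases hc : c = 0 <;> simp [nz, hc, Q]
    rw [sum_congr rfl fun c _ => e c, sum_add_distrib]
    simp only [sum_const, card_univ, nsmul_eq_mul, sum_ite_eq', mem_univ, if_true]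
    ring
  have ha0 : ∀ a : F, (if a = 0 then 0 else
      ∑ c : K, f (hammingNorm (traceWord τ (a, (0 : F), c)))) = if a = 0 then 0 else
        ∑ c : K, f (Q ^ (n + 1) * (Q ^ (n + 1) - Q ^ n - sqBias τ a c + nz c) / 2 +
          nz (τ a)) := by
    intro a
    split_ifs with ha
    · rfl
    · rw [← Equiv.sum_comp (Equiv.neg K)]
      refine sum_congr rfl fun c _ => ?_
      rw [Equiv.neg_apply, weight_zero hF h2 hτ ha c]
  have hsplit : ∀ a : F, ∑ b : F, ∑ c : K, f (hammingNorm (traceWord τ (a, b, c))) =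
      ∑ c : K, f (hammingNorm (traceWord τ (a, (0 : F), c))) +
      Q * ((Q ^ n - 1) * f ((Q ^ (n + 1) + 1) / 2 * (Q ^ (n + 1) - Q ^ n) + nz (τ a)) +
        (Q ^ (n + 1) - Q ^ n) *
          f ((Q ^ (n + 1) + 1) / 2 * (Q ^ (n + 1) - Q ^ n) + (nz (τ a) + 1))) := by
    intro a
    rw [sum_split_zero, hb]
  rw [sum_congr rfl fun a _ => hsplit a, sum_add_distrib,
    sum_nz_form hF hτ (fun t => Q * ((Q ^ n - 1) *
      f ((Q ^ (n + 1) + 1) / 2 * (Q ^ (n + 1) - Q ^ n) + t) + (Q ^ (n + 1) - Q ^ n) *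
          f ((Q ^ (n + 1) + 1) / 2 * (Q ^ (n + 1) - Q ^ n) + (t + 1)))),
    sum_split_zero, h00, sum_congr rfl fun a _ => ha0 a]
  simp only [add_zero, zero_add, one_add_one_eq_two]
  ring

/-- Take for `f` the indicator of a single weight. -/
theorem hasWeightTable_range_traceWord (h2 : ringChar K ≠ 2) {τ : F →ₗ[K] K} (hτ : τ ≠ 0)
    {T : List (ℚ × ℚ)} (hT : ∀ f : ℚ → ℚ, ∑ v : F × F × K, f (hammingNorm (traceWord τ v)) =
      (T.map fun r => r.2 * f r.1).sum) :
    HasWeightTable (LinearMap.range (traceWord τ)) T := by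
  intro w
  have h := hT fun x => if x = (w : ℚ) then 1 else 0
  simp only [mul_ite, mul_one, mul_zero, Nat.cast_inj] at h
  rw [← h, sum_boole]
  have hset : {c : Pos F → K | c ∈ LinearMap.range (traceWord τ) ∧ hammingNorm c = w} =
      traceWord τ '' ((univ.filter fun v => hammingNorm (traceWord τ v) = w : Finset _) :
        Set (F × F × K)) := by
    ext c
    simp only [Set.mem_ofPred_eq, LinearMap.mem_range, Set.mem_image, coe_filter, mem_univ,
      true_and]
    constructor
    · rintro ⟨⟨v, rfl⟩, hv⟩; exact ⟨v, hv, rfl⟩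
    · rintro ⟨v, hv, rfl⟩; exact ⟨⟨v, rfl⟩, hv⟩
  rw [weightCount, hset, Set.ncard_image_of_injective _ (traceWord_injective h2 hτ),
    Set.ncard_coe_finset]

theorem sum_weights_odd {j : ℕ} (hF : Fintype.card F = Fintype.card K ^ (2 * j + 1))
    (h2 : ringChar K ≠ 2) {τ : F →ₗ[K] K} (hτ : τ ≠ 0) (f : ℚ → ℚ) {Q R A q u : ℚ}
    (hQ : Q = Fintype.card K) (hR : R = Q ^ j) (hA : A = Q ^ (2 * j)) (hq : q = Q ^ (2 * j + 1))
    (hu : u = (q + 1) / 2 * (q - A)) :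
    ∑ v : F × F × K, f (hammingNorm (traceWord τ v)) =
      f 0 + (Q - 1) * f ((q + 1) / 2 * q) +
      Q * A * (A - 1) * f u + Q * (q - A) * (2 * A - 1) * f (u + 1) +
      Q * (q - A) ^ 2 * f (u + 2) +
      ((A - 1) * f (q * (q - A) / 2) + (q - A) * f (q * (q - A) / 2 + 1) +
      (Q - 1) / 2 * ((A - 1) * f (q * (q - A - R + 1) / 2) +
        (q - A) * f (q * (q - A - R + 1) / 2 + 1) +
        (A - 1) * f (q * (q - A + R + 1) / 2) +
        (q - A) * f (q * (q - A + R + 1) / 2 + 1))) := by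
  rw [sum_weights hF h2 hτ f hQ hA hq hu]
  congr 1
  have hinner : ∀ a : F, a ≠ 0 →
      ∑ c : K, f (q * (q - A - sqBias τ a c + nz c) / 2 + nz (τ a)) =
      f (q * (q - A) / 2 + nz (τ a)) + (Q - 1) / 2 * (f (q * (q - A - R + 1) / 2 + nz (τ a)) +
        f (q * (q - A + R + 1) / 2 + nz (τ a))) := by
    intro a ha
    -- The sign of `e` may vary with `a`, but both signs of the character of `c` occur equally
    -- often, so it drops out.
    obtain ⟨e, he, hd⟩ := sqBias_of_odd hF h2 hτ ha
    have hH := sum_quadraticChar_ne_zero h2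
      (fun x => f (q * (q - A - ((x * e : ℤ) : ℚ) + 1) / 2 + nz (τ a)))
    rw [sum_split_zero]
    have e1 : ∀ c : K, (if c = 0 then 0 else
        f (q * (q - A - sqBias τ a c + nz c) / 2 + nz (τ a))) = if c = 0 then 0 else
        f (q * (q - A - ((quadraticChar K c * e : ℤ) : ℚ) + 1) / 2 + nz (τ a)) := by
      intro c
      split_ifs with hc
      · rfl
      · rw [hd c]; simp only [nz, hc, if_false]
    rw [sum_congr rfl fun c _ => e1 c, hH, hd 0, quadraticChar_zero, ← hQ]
    rcases he with rfl | rfl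
    · simp [nz, hR, hQ]
    · simp only [nz, hR, hQ, if_true, zero_mul, Int.cast_zero, sub_zero, add_zero, one_mul,
        neg_mul, neg_neg, Int.cast_neg, Int.cast_pow, Int.cast_natCast, sub_neg_eq_add]
      ring
  have h1 := sum_nz_form_ne_zero hF hτ (fun t =>
      f (q * (q - A) / 2 + t) + (Q - 1) / 2 * (f (q * (q - A - R + 1) / 2 + t) +
        f (q * (q - A + R + 1) / 2 + t)))
  rw [← hQ, ← hq, ← hA] at h1
  rw [sum_congr rfl fun a _ => ite_congr rfl (fun _ => rfl) (hinner a), h1]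
  simp only [add_zero]
  ring

theorem sum_weights_even {j : ℕ} (hF : Fintype.card F = Fintype.card K ^ (2 * j + 2))
    (h2 : ringChar K ≠ 2) {τ : F →ₗ[K] K} (hτ : τ ≠ 0) :
    ∃ R : ℚ, (R = (Fintype.card K : ℚ) ^ j ∨ R = -(Fintype.card K : ℚ) ^ j) ∧
    ∀ (f : ℚ → ℚ) {Q A q u : ℚ}
    (_ : Q = Fintype.card K) (_ : A = Q ^ (2 * j + 1)) (_ : q = Q ^ (2 * j + 2))
    (_ : u = (q + 1) / 2 * (q - A)),
    ∑ v : F × F × K, f (hammingNorm (traceWord τ v)) =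
      f 0 + (Q - 1) * f ((q + 1) / 2 * q) +
      Q * A * (A - 1) * f u + Q * (q - A) * (2 * A - 1) * f (u + 1) +
      Q * (q - A) ^ 2 * f (u + 2) +
      ((A - 1 + (Q - 1) * R) / 2 *
          (f (q * (q - A - (Q - 1) * R) / 2) + (Q - 1) * f (q * (q - A + R + 1) / 2)) +
        (A - 1 - (Q - 1) * R) / 2 *
          (f (q * (q - A + (Q - 1) * R) / 2) + (Q - 1) * f (q * (q - A - R + 1) / 2)) +
        (q - A - (Q - 1) * R) / 2 *
          (f (q * (q - A - (Q - 1) * R) / 2 + 1) + (Q - 1) * f (q * (q - A + R + 1) / 2 + 1)) +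
        (q - A + (Q - 1) * R) / 2 *
          (f (q * (q - A + (Q - 1) * R) / 2 + 1) +
            (Q - 1) * f (q * (q - A - R + 1) / 2 + 1))) := by
  obtain ⟨e, he, hd⟩ := sqBias_of_even hF h2 hτ
  refine ⟨e, ?_, ?_⟩
  · rcases he with rfl | rfl <;> simp
  intro f Q A q u hQ hA hq hu
  rw [sum_weights hF h2 hτ f hQ hA hq hu]
  congr 1
  have hinner : ∀ a : F, a ≠ 0 →
      ∑ c : K, f (q * (q - A - sqBias τ a c + nz c) / 2 + nz (τ a)) =
      f (q * (q - A - ((quadraticChar F a : ℤ) : ℚ) * ((Q - 1) * e)) / 2 + nz (τ a)) +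
        (Q - 1) * f (q * (q - A + ((quadraticChar F a : ℤ) : ℚ) * e + 1) / 2 + nz (τ a)) := by
    intro a ha
    have e1 : ∀ c : K, f (q * (q - A - sqBias τ a c + nz c) / 2 + nz (τ a)) =
        f (q * (q - A + ((quadraticChar F a : ℤ) : ℚ) * e + 1) / 2 + nz (τ a)) +
        if c = 0 then f (q * (q - A - ((quadraticChar F a : ℤ) : ℚ) * ((Q - 1) * e)) / 2 +
          nz (τ a)) - f (q * (q - A + ((quadraticChar F a : ℤ) : ℚ) * e + 1) / 2 + nz (τ a))
        else 0 := by
      intro c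
      split_ifs with hc
      · subst hc
        rw [(hd a ha).1]
        simp [nz, hQ]
      · rw [(hd a ha).2 c hc]
        simp [nz, hc]
    rw [sum_congr rfl fun c _ => e1 c, sum_add_distrib]
    simp only [sum_const, card_univ, nsmul_eq_mul, sum_ite_eq', mem_univ, if_true, ← hQ]
    ring
  have h1 := sum_quadraticChar_nz_ne_zero hF h2 hτ (fun x t =>
      f (q * (q - A - (x : ℚ) * ((Q - 1) * e)) / 2 + t) +
        (Q - 1) * f (q * (q - A + (x : ℚ) * e + 1) / 2 + t))
  have h3 : (sqBias τ 1 0 : ℚ) = (Q - 1) * e := by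
    rw [(hd 1 one_ne_zero).1, hQ]; simp
  rw [← hQ, ← hq, ← hA, h3] at h1
  rw [sum_congr rfl fun a _ => ite_congr rfl (fun _ => rfl) (hinner a), h1]
  simp only [add_zero, Int.cast_one, Int.cast_neg, one_mul, neg_mul, sub_neg_eq_add,
    ← sub_eq_add_neg]

theorem hasWeightTable_odd {p : ℕ} (hp : Fintype.card K = p) {j : ℕ}
    (hF : Fintype.card F = p ^ (2 * j + 1)) (h2 : ringChar K ≠ 2) {τ : F →ₗ[K] K} (hτ : τ ≠ 0) :
    HasWeightTable (LinearMap.range (traceWord τ)) (tableOdd p (2 * j + 1)) := by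
  refine hasWeightTable_range_traceWord h2 hτ fun f => ?_
  subst hp
  rw [sum_weights_odd hF h2 hτ f rfl rfl rfl rfl rfl, tableOdd, tableCommon]
  have e1 : 2 * (2 * j + 1) - 1 = 4 * j + 1 := by omega
  have e2 : 2 * j + 1 - 1 = 2 * j := by omega
  have e3 : (3 * (2 * j + 1) - 1) / 2 = 3 * j + 1 := by omega
  simp only [e1, e2, e3, List.cons_append, List.nil_append, List.map_cons, List.map_nil,
    List.sum_cons, List.sum_nil]
  -- A change of sign exchanges `w₁` and `w₂`, whose multiplicities agree.
  rcases neg_one_pow_eq_or ℚ ((2 * j + 1 + 1) * (Fintype.card K - 1) / 4) with h | h <;>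
    rw [h] <;> ring_nf

theorem hasWeightTable_even {p : ℕ} (hp : Fintype.card K = p) {j : ℕ}
    (hF : Fintype.card F = p ^ (2 * j + 2)) (h2 : ringChar K ≠ 2) {τ : F →ₗ[K] K} (hτ : τ ≠ 0) :
    HasWeightTable (LinearMap.range (traceWord τ)) (tableEven p (2 * j + 2)) := by
  subst hp
  obtain ⟨R, hR, hsum⟩ := sum_weights_even hF h2 hτ
  refine hasWeightTable_range_traceWord h2 hτ fun f => ?_
  rw [hsum f rfl rfl rfl rfl, tableEven, tableCommon]
  have e1 : 2 * (2 * j + 2) - 1 = 4 * j + 3 := by omega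
  have e2 : 2 * j + 2 - 1 = 2 * j + 1 := by omega
  have e3 : (3 * (2 * j + 2) - 2) / 2 = 3 * j + 2 := by omega
  have e4 : (2 * j + 2 - 2) / 2 = j := by omega
  simp only [e1, e2, e3, e4, List.cons_append, List.nil_append, List.map_cons, List.map_nil,
    List.sum_cons, List.sum_nil]
  -- A change of sign exchanges `v₁` with `v₂` and `w₁` with `w₂`, together with their
  -- multiplicities, so all four sign combinations give the same table.
  rcases neg_one_pow_eq_or ℚ ((2 * j + 2) * (Fintype.card K - 1) / 4) with h | h <;>
    rcases hR with rfl | rfl <;> rw [h] <;> ring_nf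

end WeightDistribution

/-! ### Minimum distance and optimality of the dual -/

section MinimumDistance

open Finset

set_option linter.unusedSectionVars false

variable {K F : Type*} [Field K] [Fintype K] [DecidableEq K] [Field F] [Fintype F]
  [DecidableEq F] [Algebra K F]

theorem nz_nonneg (k : K) : 0 ≤ nz k := by
  unfold nz; split_ifs <;> norm_num

theorem isMinDist_range_traceWord {n : ℕ} (hF : Fintype.card F = Fintype.card K ^ (n + 1))
    (h2 : ringChar K ≠ 2) {τ : F →ₗ[K] K} (hτ : τ ≠ 0) {Q A q : ℚ}
    (hQ : Q = Fintype.card K) (hA : A = Q ^ n) (hq : q = Q ^ (n + 1)) {d : ℕ}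
    (h1 : (d : ℚ) ≤ (q + 1) / 2 * q)
    (hb : ∀ b : F, b ≠ 0 → (d : ℚ) ≤ (q + 1) / 2 * (q - A) + nz (τ b))
    (ha : ∀ a : F, a ≠ 0 → ∀ c : K,
      (d : ℚ) ≤ q * (q - A - sqBias τ a c + nz c) / 2 + nz (τ a))
    (hex : ∃ a : F, a ≠ 0 ∧ ∃ c : K,
      (d : ℚ) = q * (q - A - sqBias τ a c + nz c) / 2 + nz (τ a)) :
    IsMinDist (LinearMap.range (traceWord τ)) d := by
  subst hQ hA hq
  refine isMinDist_of_weights ?_ ?_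
  · rintro _ ⟨⟨a, b, c⟩, rfl⟩ h0
    rw [← Nat.cast_le (α := ℚ)]
    by_cases hb0 : b = 0
    · subst hb0
      by_cases ha0 : a = 0
      · subst ha0
        have hc : c ≠ 0 := by
          rintro rfl
          exact h0 (map_zero (traceWord τ))
        rw [weight_zero_zero hF h2 τ c]
        simpa [nz, hc] using h1
      · have := ha a ha0 (-c)
        rwa [← weight_zero hF h2 hτ ha0, neg_neg] at this
    · rw [weight_of_ne_zero hF h2 hτ a hb0 c]
      linarith [hb b hb0, nz_nonneg (τ a)]
  · obtain ⟨a, ha0, c, hc⟩ := hex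
    refine ⟨_, ⟨(a, 0, -c), rfl⟩, ?_, ?_⟩
    · intro h
      rw [← map_zero (traceWord τ)] at h
      exact ha0 (congrArg Prod.fst (traceWord_injective h2 hτ h))
    · rw [← Nat.cast_inj (R := ℚ), weight_zero hF h2 hτ ha0, hc]

theorem exists_weight_eq {n : ℕ} (hF : Fintype.card F = Fintype.card K ^ (n + 1))
    (h2 : ringChar K ≠ 2) {τ : F →ₗ[K] K} (hτ : τ ≠ 0) {a : F} (ha : a ≠ 0) (c : K) :
    ∃ d : ℕ, (d : ℚ) = (Fintype.card K : ℚ) ^ (n + 1) * ((Fintype.card K : ℚ) ^ (n + 1) -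
      (Fintype.card K : ℚ) ^ n - sqBias τ a c + nz c) / 2 + nz (τ a) :=
  ⟨_, weight_zero hF h2 hτ ha c⟩

theorem exists_ne_zero_form_eq_zero {n : ℕ} (hn : 0 < n)
    (hF : Fintype.card F = Fintype.card K ^ (n + 1)) {τ : F →ₗ[K] K} (hτ : τ ≠ 0) :
    ∃ a : F, a ≠ 0 ∧ τ a = 0 := by
  have h := card_fiber_linearForm hF hτ 0
  have h1 : 1 < #{x | τ x = 0} := by
    rw [h]; exact Nat.one_lt_pow hn.ne' Fintype.one_lt_card
  obtain ⟨a, ha, ha0⟩ := exists_mem_ne h1 0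
  exact ⟨a, ha0, by simpa using ha⟩

theorem isMinDist_of_odd {j : ℕ} (hj : 0 < j) (hF : Fintype.card F = Fintype.card K ^ (2 * j + 1))
    (h2 : ringChar K ≠ 2) {τ : F →ₗ[K] K} (hτ : τ ≠ 0) :
    ∃ d : ℕ, IsMinDist (LinearMap.range (traceWord τ)) d ∧
      2 * d + Fintype.card K ^ (4 * j + 1) + Fintype.card K ^ (3 * j + 1) =
        Fintype.card K ^ (4 * j + 2) + Fintype.card K ^ (2 * j + 1) := by
  -- The minimum is reached at `b = 0`, with `τ a = 0` and the largest bias `Q ^ j`. A nonzero such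
  -- `a` exists because `j > 0`.
  obtain ⟨a, ha, hτa⟩ := exists_ne_zero_form_eq_zero (by omega) hF hτ
  obtain ⟨c, hc, hac⟩ : ∃ c : K, c ≠ 0 ∧ (sqBias τ a c : ℚ) = (Fintype.card K : ℚ) ^ j := by
    obtain ⟨e, he, hd⟩ := sqBias_of_odd hF h2 hτ ha
    rcases he with rfl | rfl
    · exact ⟨1, one_ne_zero, by rw [hd]; simp⟩
    · obtain ⟨k, hk⟩ := quadraticChar_exists_neg_one h2
      refine ⟨k, ?_, by rw [hd, hk]; simp⟩
      rintro rfl; simp at hk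
  obtain ⟨d, hd⟩ := exists_weight_eq hF h2 hτ ha c
  have hQ1 : (1 : ℚ) ≤ Fintype.card K := by exact_mod_cast Fintype.card_pos
  generalize hQ : (Fintype.card K : ℚ) = Q at *
  have hR1 : 1 ≤ Q ^ j := one_le_pow₀ hQ1
  have eA : Q ^ (2 * j) = (Q ^ j) ^ 2 := by ring
  have eq : Q ^ (2 * j + 1) = Q * (Q ^ j) ^ 2 := by ring
  have hd' : (d : ℚ) = Q * (Q ^ j) ^ 2 * (Q * (Q ^ j) ^ 2 - (Q ^ j) ^ 2 - Q ^ j + 1) / 2 := by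
    rw [hd, hac, hτa, eA, eq]; simp [nz, hc]
  refine ⟨d, isMinDist_range_traceWord hF h2 hτ hQ.symm rfl rfl ?_ ?_ ?_ ⟨a, ha, c, hd⟩, ?_⟩
  · rw [hd', eq]
    generalize Q ^ j = R at *
    have : 0 ≤ Q * R ^ 2 * (R ^ 2 + R) := by positivity
    nlinarith
  · intro b _
    refine le_trans ?_ (le_add_of_nonneg_right (nz_nonneg _))
    rw [hd', eq, eA]
    generalize Q ^ j = R at *
    have : R ^ 2 * 1 ≤ R ^ 2 * (Q * R) :=
      mul_le_mul_of_nonneg_left (one_le_mul_of_one_le_of_one_le hQ1 hR1) (by positivity)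
    nlinarith
  · intro a' ha' c'
    refine le_trans ?_ (le_add_of_nonneg_right (nz_nonneg _))
    have hbias : (sqBias τ a' c' : ℚ) - nz c' ≤ Q ^ j - 1 := by
      obtain ⟨e, he, hd⟩ := sqBias_of_odd hF h2 hτ ha'
      rw [hd]
      by_cases hc' : c' = 0
      · simp [nz, hc', hR1]
      · rcases quadraticChar_dichotomy hc' with h | h <;> rcases he with rfl | rfl <;> rw [h] <;>
          simp [nz, hc', hQ] <;> linarith
    rw [hd', eq, eA]
    have hpos : 0 ≤ Q * (Q ^ j) ^ 2 := by positivity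
    have := mul_le_mul_of_nonneg_left hbias hpos
    linarith
  · have : (2 * d + Q ^ (4 * j + 1) + Q ^ (3 * j + 1) : ℚ) = Q ^ (4 * j + 2) + Q ^ (2 * j + 1) := by
      rw [hd']; ring
    rw [← hQ] at this
    exact_mod_cast this

theorem isMinDist_of_card_eq (hF : Fintype.card F = Fintype.card K)
    (h2 : ringChar K ≠ 2) {τ : F →ₗ[K] K} (hτ : τ ≠ 0) :
    ∃ d : ℕ, IsMinDist (LinearMap.range (traceWord τ)) d ∧
      2 * d + Fintype.card K = Fintype.card K ^ 2 + 2 := by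
  have hF0 : Fintype.card F = Fintype.card K ^ (0 + 1) := by rw [hF]; ring
  have hF1 : Fintype.card F = Fintype.card K ^ (2 * 0 + 1) := by rw [hF]; ring
  -- In degree one `τ` has trivial kernel, so the coordinate `τ a` always adds one to the weight.
  have hnz : ∀ a : F, a ≠ 0 → nz (τ a) = 1 := by
    intro a ha
    have h := card_fiber_linearForm hF0 hτ 0
    rw [pow_zero, card_eq_one] at h
    obtain ⟨z, hz⟩ := h
    have h0 : (0 : F) ∈ univ.filter fun x => τ x = 0 := by simp
    rw [hz, mem_singleton] at h0
    have : τ a ≠ 0 := by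
      intro hτa
      have h1 : a ∈ univ.filter fun x => τ x = 0 := by simpa using hτa
      rw [hz, mem_singleton, ← h0] at h1
      exact ha h1
    simp [nz, this]
  have hbias : ∀ a : F, a ≠ 0 → sqBias τ a 0 = 0 := by
    intro a ha
    obtain ⟨e, _, hd⟩ := sqBias_of_odd hF1 h2 hτ ha
    rw [hd, quadraticChar_zero, zero_mul]
  obtain ⟨d, hd⟩ := exists_weight_eq hF0 h2 hτ one_ne_zero 0
  have hQ1 : (1 : ℚ) ≤ Fintype.card K := by exact_mod_cast Fintype.card_pos
  generalize hQ : (Fintype.card K : ℚ) = Q at *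
  have hd' : (d : ℚ) = Q * (Q - 1) / 2 + 1 := by
    rw [hd, hbias 1 one_ne_zero, hnz 1 one_ne_zero]; simp [nz]
  refine ⟨d, isMinDist_range_traceWord hF0 h2 hτ hQ.symm rfl rfl ?_ ?_ ?_
    ⟨1, one_ne_zero, 0, hd⟩, ?_⟩
  · rw [hd']; ring_nf; nlinarith
  · intro b hb
    rw [hd', hnz b hb]; ring_nf; nlinarith
  · intro a' ha' c'
    have h1 : (sqBias τ a' c' : ℚ) - nz c' ≤ 0 := by
      obtain ⟨e, he, hd⟩ := sqBias_of_odd hF1 h2 hτ ha'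
      rw [hd]
      by_cases hc' : c' = 0
      · simp [nz, hc']
      · rcases quadraticChar_dichotomy hc' with h | h <;> rcases he with rfl | rfl <;> rw [h] <;>
          simp [nz, hc']
    rw [hd', hnz a' ha']
    have := mul_le_mul_of_nonneg_left h1 (zero_le_one.trans hQ1)
    simp only [zero_add, pow_one, pow_zero]
    linarith
  · have : (2 * d + Q : ℚ) = Q ^ 2 + 2 := by
      rw [hd']; ring
    rw [← hQ] at this
    exact_mod_cast this

theorem isMinDist_of_even {j : ℕ} (hF : Fintype.card F = Fintype.card K ^ (2 * j + 2))
    (h2 : ringChar K ≠ 2) {τ : F →ₗ[K] K} (hτ : τ ≠ 0) :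
    ∃ d : ℕ, IsMinDist (LinearMap.range (traceWord τ)) d ∧
      2 * d + Fintype.card K ^ (4 * j + 3) + (Fintype.card K - 1) * Fintype.card K ^ (3 * j + 2) =
        Fintype.card K ^ (4 * j + 4) := by
  obtain ⟨e, he, hbias⟩ := sqBias_of_even hF h2 hτ
  have hQ2 : (2 : ℚ) ≤ Fintype.card K := by exact_mod_cast Fintype.one_lt_card (α := K)
  have hcast : ((Fintype.card K - 1 : ℕ) : ℚ) = (Fintype.card K : ℚ) - 1 :=
    Nat.cast_pred Fintype.card_pos
  -- The number of such `a` is `(A - 1 + (Q - 1) Q^j) / 2` for either sign of `e`, hence positive.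
  obtain ⟨a, ha, hτa, hae⟩ : ∃ a : F, a ≠ 0 ∧ τ a = 0 ∧
      (quadraticChar F a : ℚ) * e = (Fintype.card K : ℚ) ^ j := by
    by_contra! hno
    have hsum := sum_quadraticChar_nz_ne_zero hF h2 hτ
      (fun x t => if (x : ℚ) * e = (Fintype.card K : ℚ) ^ j ∧ t = 0 then 1 else 0)
    have hzero : ∀ a : F, (if a = 0 then (0 : ℚ) else
        if ((quadraticChar F a : ℤ) : ℚ) * e = (Fintype.card K : ℚ) ^ j ∧ nz (τ a) = 0
          then 1 else 0) = 0 := by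
      intro a
      by_cases ha : a = 0
      · simp [ha]
      · by_cases hτa : τ a = 0
        · rw [if_neg ha, if_neg fun h => hno a ha hτa h.1]
        · simp [nz, hτa]
    have hR1 : (1 : ℚ) ≤ (Fintype.card K : ℚ) ^ j := one_le_pow₀ (by linarith)
    have hne : -(Fintype.card K : ℚ) ^ j ≠ (Fintype.card K : ℚ) ^ j := by linarith
    have hA1 : (1 : ℚ) ≤ (Fintype.card K : ℚ) ^ (2 * j + 1) := one_le_pow₀ (by linarith)
    have hpos : 0 < ((Fintype.card K : ℚ) - 1) * (Fintype.card K : ℚ) ^ j :=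
      mul_pos (by linarith) (by linarith)
    rw [sum_congr rfl fun a _ => hzero a, (hbias 1 one_ne_zero).1] at hsum
    rcases he with rfl | rfl <;> simp [hne] at hsum <;> linarith
  obtain ⟨d, hd⟩ := exists_weight_eq hF h2 hτ ha 0
  have hle : ∀ a : F, a ≠ 0 → |(quadraticChar F a : ℚ) * e| ≤ (Fintype.card K : ℚ) ^ j := by
    intro a ha
    have h0 : (0 : ℚ) ≤ (Fintype.card K : ℚ) ^ j := by positivity
    rcases quadraticChar_dichotomy ha with h | h <;> rcases he with rfl | rfl <;> rw [h] <;>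
      simp
  have hbias0 : ∀ a : F, a ≠ 0 → (sqBias τ a 0 : ℚ) =
      ((Fintype.card K : ℚ) - 1) * ((quadraticChar F a : ℚ) * e) := by
    intro a ha
    rw [(hbias a ha).1]; push_cast; ring
  have hbias1 : ∀ a : F, a ≠ 0 → ∀ c : K, c ≠ 0 → (sqBias τ a c : ℚ) =
      -((quadraticChar F a : ℚ) * e) := by
    intro a ha c hc
    rw [(hbias a ha).2 c hc]; push_cast; ring
  generalize hQ : (Fintype.card K : ℚ) = Q at *
  have hR1 : 1 ≤ Q ^ j := one_le_pow₀ (by linarith)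
  have eA : Q ^ (2 * j + 1) = Q * (Q ^ j) ^ 2 := by ring
  have eq : Q ^ (2 * j + 1 + 1) = Q ^ 2 * (Q ^ j) ^ 2 := by ring
  have hd' : (d : ℚ) = Q ^ 2 * (Q ^ j) ^ 2 *
      (Q ^ 2 * (Q ^ j) ^ 2 - Q * (Q ^ j) ^ 2 - (Q - 1) * Q ^ j) / 2 := by
    rw [hd, hbias0 a ha, hae, hτa, eA, eq]; simp [nz]
  have hmul : 0 ≤ Q ^ 2 * (Q ^ j) ^ 2 * ((Q - 1) * Q ^ j) :=
    mul_nonneg (by positivity) (mul_nonneg (by linarith) (by linarith))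
  refine ⟨d, isMinDist_range_traceWord hF h2 hτ hQ.symm rfl rfl ?_ ?_ ?_ ⟨a, ha, 0, hd⟩, ?_⟩
  · rw [hd', eq]
    generalize Q ^ j = R at *
    have h3 : 0 ≤ Q ^ 2 * R ^ 2 * (Q * R ^ 2) := by positivity
    have h4 : 0 ≤ Q ^ 2 * R ^ 2 := by positivity
    linarith
  · intro b _
    refine le_trans ?_ (le_add_of_nonneg_right (nz_nonneg _))
    rw [hd', eq, eA]
    generalize Q ^ j = R at *
    have h3 : 0 ≤ Q * R ^ 2 * (Q - 1) := mul_nonneg (by positivity) (by linarith)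
    linarith
  · intro a' ha' c'
    refine le_trans ?_ (le_add_of_nonneg_right (nz_nonneg _))
    have h1 := abs_le.1 (hle a' ha')
    have h3 : (sqBias τ a' c' : ℚ) - nz c' ≤ (Q - 1) * Q ^ j := by
      by_cases hc' : c' = 0
      · subst hc'
        rw [hbias0 a' ha']
        simp only [nz, if_true, sub_zero]
        exact mul_le_mul_of_nonneg_left h1.2 (by linarith)
      · rw [hbias1 a' ha' c' hc']
        simp only [nz, hc', if_false]
        nlinarith
    rw [hd', eq, eA]
    have hpos : 0 ≤ Q ^ 2 * (Q ^ j) ^ 2 := by positivity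
    have := mul_le_mul_of_nonneg_left h3 hpos
    linarith
  · have : (2 * d + Q ^ (4 * j + 3) + (Q - 1) * Q ^ (3 * j + 2) : ℚ) = Q ^ (4 * j + 4) := by
      rw [hd']; ring
    rw [← hcast, ← hQ] at this
    exact_mod_cast this

/-! ### The parameters of the dual -/

theorem finrank_le_of_hammingBound {K ι : Type*} [Field K] [Fintype K] [DecidableEq K]
    [Fintype ι] {k r : ℕ} (hr : Fintype.card K ^ r < 1 + (Fintype.card K - 1) * Fintype.card ι)
    (hk : Fintype.card K ^ k * (1 + (Fintype.card K - 1) * Fintype.card ι) ≤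
      Fintype.card K ^ Fintype.card ι) : k + r < Fintype.card ι := by
  rw [← Nat.pow_lt_pow_iff_right (Fintype.one_lt_card (α := K)), pow_add]
  exact lt_of_lt_of_le (Nat.mul_lt_mul_of_pos_left hr (pow_pos Fintype.card_pos k)) hk

/-- If a ball of radius one has more than `Q ^ r` elements, the bound forces codimension at least `r
+ 1`, which `C` attains. -/
theorem isDimensionOptimal_of_card {K ι : Type*} [Field K] [Fintype K] [DecidableEq K]
    [Fintype ι] {C : Submodule K (ι → K)} (hC : IsMinDist C 3) {r : ℕ}
    (hCr : Module.finrank K C + r + 1 = Fintype.card ι)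
    (hr : Fintype.card K ^ r < 1 + (Fintype.card K - 1) * Fintype.card ι) :
    IsDimensionOptimal C := by
  refine ⟨3, hC, ?_, ?_⟩
  · intro k hk
    have hk' : Fintype.card K ^ k * (1 + (Fintype.card K - 1) * Fintype.card ι) ≤
        Fintype.card K ^ Fintype.card ι := by
      simpa [SpherePackingBound, sum_range_succ] using hk
    have := finrank_le_of_hammingBound hr hk'
    omega
  · intro D d hD hd
    have := finrank_le_of_hammingBound hr (hammingBound_radius_one D fun c hc h0 =>
      hd.trans (weight_ge_of_isMinDist hD hc h0))
    omega

end MinimumDistance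

/-- `F` is `GF(p ^ m)` with `p` odd, `G` is any generator matrix of `C₁` and `B` any basis of
`F` over `GF(p)`. All subtractions and divisions of natural numbers below are exact. -/
theorem theorem3p2 (p m : ℕ) [Fact p.Prime] (hp : p ≠ 2) (hm : 0 < m)
    (F : Type*) [Field F] [Fintype F] [DecidableEq F] [Algebra (ZMod p) F]
    (hF : Fintype.card F = p ^ m)
    (G : Matrix (Fin 3) (Pos F) F) (hG : IsGeneratorMatrix G (codeC1 F))
    (B : Module.Basis (Fin m) (ZMod p) F) :
    (m = 1 →
      IsCode (subfieldCode B G) ((p ^ 2 + p) / 2 + 2) 3 ((p ^ 2 - p + 2) / 2) ∧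
      IsCode (dualCode (subfieldCode B G)) ((p ^ 2 + p) / 2 + 2) ((p ^ 2 + p) / 2 - 1) 3 ∧
      IsAlmostMDS (dualCode (subfieldCode B G))) ∧
    (Odd m → 1 < m →
      IsCode (subfieldCode B G) ((p ^ (2 * m) + p ^ m) / 2 + 2) (2 * m + 1)
        ((p ^ (2 * m) + p ^ m - p ^ (2 * m - 1) - p ^ ((3 * m - 1) / 2)) / 2)) ∧
    (Odd m → HasWeightTable (subfieldCode B G) (tableOdd p m)) ∧
    (Even m →
      IsCode (subfieldCode B G) ((p ^ (2 * m) + p ^ m) / 2 + 2) (2 * m + 1)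
        ((p ^ (2 * m) - p ^ (2 * m - 1) - (p - 1) * p ^ ((3 * m - 2) / 2)) / 2) ∧
      HasWeightTable (subfieldCode B G) (tableEven p m)) ∧
    IsCode (dualCode (subfieldCode B G)) ((p ^ (2 * m) + p ^ m) / 2 + 2)
      ((p ^ (2 * m) + p ^ m) / 2 - 2 * m + 1) 3 ∧
    IsDimensionOptimal (dualCode (subfieldCode B G)) := by

  have hK : Fintype.card (ZMod p) = p := ZMod.card p
  have h2 : ringChar (ZMod p) ≠ 2 := by rwa [ZMod.ringChar_zmod_n]
  have : FiniteDimensional (ZMod p) F := B.finiteDimensional_of_finite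
  have hfr : Module.finrank (ZMod p) F = m := by
    rw [Module.finrank_eq_card_basis B, Fintype.card_fin]
  obtain ⟨τ, hτ⟩ : ∃ τ : F →ₗ[ZMod p] ZMod p, τ ≠ 0 :=
    ⟨B.coord ⟨0, hm⟩, fun h => by
      have := LinearMap.congr_fun h (B ⟨0, hm⟩)
      simp at this⟩
  rw [subfieldCode_eq_range B G hG.2 hτ]
  have hdim : Module.finrank (ZMod p) (LinearMap.range (traceWord τ)) = 2 * m + 1 := by
    rw [finrank_range_traceWord h2 hτ, hfr]
  have hcard2 : 2 * Fintype.card (Pos F) = p ^ (2 * m) + p ^ m + 4 := by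
    rw [two_mul_card_pos (ringChar_algebra_ne_two h2), hF, ← pow_mul, mul_comm m]
  have hcard : Fintype.card (Pos F) = (p ^ (2 * m) + p ^ m) / 2 + 2 := by omega
  have hp3 : 3 ≤ p := by
    have := (Fact.out : p.Prime).two_le
    omega
  -- With `hp2m` this makes `(p ^ (2 * m) + p ^ m) / 2` exceed `2 * m`, so the dual dimension
  -- involves no truncated subtraction.
  have hpm : m < p ^ m := Nat.lt_pow_self (by omega)
  have hp2m : 3 * p ^ m ≤ p ^ (2 * m) := by
    rw [two_mul, pow_add]
    exact Nat.mul_le_mul_right _ (hp3.trans (Nat.le_self_pow hm.ne' p))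
  have hdual := finrank_dualCode (LinearMap.range (traceWord τ))
  rw [hdim] at hdual
  have hmin := isMinDist_dualCode_range_traceWord hτ
  refine ⟨?_, ?_, ?_, ?_, ⟨hcard, by omega, hmin⟩, ?_⟩
  · rintro rfl
    have hpp : p ≤ p ^ 2 := Nat.le_self_pow two_ne_zero p
    rw [mul_one, pow_one] at hcard
    obtain ⟨d, hd, hd2⟩ := isMinDist_of_card_eq (by rw [hF, hK, pow_one]) h2 hτ
    rw [hK] at hd2
    have hdd : (p ^ 2 - p + 2) / 2 = d := by omega
    exact ⟨⟨hcard, hdim, hdd ▸ hd⟩, ⟨hcard, by omega, hmin⟩, 3, hmin, by omega⟩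
  · rintro ⟨j, rfl⟩ hj
    obtain ⟨d, hd, hd2⟩ := isMinDist_of_odd (j := j) (by omega) (by rw [hF, hK]) h2 hτ
    rw [hK] at hd2
    refine ⟨hcard, hdim, ?_⟩
    have e1 : 2 * (2 * j + 1) - 1 = 4 * j + 1 := by omega
    have e2 : (3 * (2 * j + 1) - 1) / 2 = 3 * j + 1 := by omega
    have e3 : 2 * (2 * j + 1) = 4 * j + 2 := by omega
    rw [e1, e2, e3]
    convert hd using 1
    omega
  · rintro ⟨j, rfl⟩
    exact hasWeightTable_odd hK hF h2 hτ
  · rintro ⟨i, hi⟩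
    obtain ⟨j, rfl⟩ : ∃ j, m = 2 * j + 2 := ⟨i - 1, by omega⟩
    obtain ⟨d, hd, hd2⟩ := isMinDist_of_even (j := j) (by rw [hF, hK]) h2 hτ
    rw [hK] at hd2
    refine ⟨⟨hcard, hdim, ?_⟩, hasWeightTable_even hK hF h2 hτ⟩
    have e1 : 2 * (2 * j + 2) - 1 = 4 * j + 3 := by omega
    have e2 : (3 * (2 * j + 2) - 2) / 2 = 3 * j + 2 := by omega
    have e3 : 2 * (2 * j + 2) = 4 * j + 4 := by omega
    rw [e1, e2, e3]
    convert hd using 1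
    omega
  · refine isDimensionOptimal_of_card hmin (r := 2 * m) (by omega) ?_
    rw [hK]
    -- As `p - 1 ≥ 2`, the ball size exceeds `2 n = p^(2m) + p^m + 4`, hence `p^(2m)`.
    have : 2 * Fintype.card (Pos F) ≤ (p - 1) * Fintype.card (Pos F) :=
      Nat.mul_le_mul_right _ (by omega)
    omega
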